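/- Let $\gamma:\mathbb{R}_+\to(0,\infty)$ be a non-increasing function and let $\alpha>0$, $c\in(0,\infty)$. Let $(\widetilde\nu,\nu)$ be a random vector with values in $\mathbb{R}_+\times\mathbb{N}$ (where $0\in\mathbb{N}$) such that $\mathbf{E}[\nu]=1$ and, as $r\to\infty$, $$\mathbf{P}(\widetilde\nu\ge r,\ \nu\ge br)\sim\gamma(b)\,r^{-\alpha}\quad\text{for every } b\ge 0,\qquad \mathbf{P}(\nu\ge r)\sim c\,r^{-\alpha}.$$ Let $M$ be an $\mathbb{R}_+$-valued random variable whose law satisfies the equation $$M\stackrel{d}{=}\max\Big\{\widetilde\nu,\ \max_{1\le k\le\nu}M_k\Big\},$$ where $M_1,M_2,\dots$ are i.i.d. copies of $M$, independent of $(\widetilde\nu,\nu)$, and the maximum over an empty index set is $0$. Here $u(r)\sim v(r)$ means $u(r)/v(r)\to1$. Then, as $r\to\infty$ through the reals: 1. if $\alpha\in(1,2)$, then $\mathbf{P}(M>r)\sim \dfrac{C}{r}$, where $C\in(0,\infty)$ is a constant that depends only on $\alpha$, $\gamma$ and $c$; 2. if $\alpha=2$, then $\mathbf{P}(M>r)\sim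 \dfrac{C}{r\sqrt{\log r}}$, where $C\in(0,\infty)$ is a constant that depends only on $\alpha$, $\gamma$ and $c$; 3. if $\alpha>2$, then $1<\mathbf{E}[\nu^2]<\infty$ and $\mathbf{P}(M>r)\sim\sqrt{\dfrac{2}{\mathbf{E}[\nu^2]-1}\,\mathbf{P}(\widetilde\nu>r)}$. -/

import Mathlib

open MeasureTheory ProbabilityTheory Filter Asymptotics
open scoped NNReal

universe u v

/-- `max {x, max_{k < n} y k}` for nonnegative reals; the inner maximum over no index is `0`. -/
noncomputable def maxWith (x : ℝ≥0) (n : ℕ) (y : ℕ → ℝ≥0) : ℝ≥0 :=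
  max x ((Finset.range n).sup y)

/-- The map that is pushed forward in `maxLaw` is measurable, so `Measure.map` has its usual
meaning there. -/
theorem measurable_maxWith :
    Measurable (fun p : (ℝ≥0 × ℕ) × (ℕ → ℝ≥0) => maxWith p.1.1 p.1.2 p.2) := by
  unfold maxWith
  refine Measurable.max (by fun_prop) ?_
  have h : ∀ n : ℕ, Measurable (fun y : ℕ → ℝ≥0 => (Finset.range n).sup y) := by
    intro n
    induction n with
    | zero => simp
    | succ n ih =>
      simp only [Finset.range_add_one, Finset.sup_insert]
      exact (measurable_pi_apply n).sup ih
  have h2 : Measurable (Function.uncurry fun (n : ℕ) (y : ℕ → ℝ≥0) => (Finset.range n).sup y) :=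
    measurable_from_prod_countable_right h
  exact h2.comp ((measurable_snd.comp measurable_fst).prodMk measurable_snd)

/-- The law of `max {x, max_{k < n} y k}` when the pair `(x, n)` has law `ρ`, the variables
`y 0, y 1, …` are i.i.d. with law `m`, and the sequence `y` is independent of `(x, n)`. -/
noncomputable def maxLaw (ρ : Measure (ℝ≥0 × ℕ)) (m : Measure ℝ≥0) [IsProbabilityMeasure m] :
    Measure ℝ≥0 :=
  (ρ.prod (Measure.infinitePi fun _ : ℕ => m)).map fun p => maxWith p.1.1 p.1.2 p.2

/-- `m` is the law of a solution `M` of the distributional equation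
`M = max {νt, max_{k ≤ ν} M_k}`, where `(νt, ν)` has law `ρ`. -/
def IsMaxFixedPoint (ρ : Measure (ℝ≥0 × ℕ)) (m : Measure ℝ≥0) [IsProbabilityMeasure m] : Prop :=
  m = maxLaw ρ m

/-- The assumptions on the pair `(νt, ν)`: it is a random vector with values in `ℝ₊ × ℕ`, the
mean of `ν` is `1` (in particular `ν` is integrable, since the Bochner integral is not `0`), and
`P(νt ≥ r, ν ≥ b r) ∼ γ(b) r^{-α}` for all `b ≥ 0` and `P(ν ≥ r) ∼ c r^{-α}` as `r → ∞`. -/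
structure HasJointTail {Ω : Type u} [MeasurableSpace Ω] (P : Measure Ω)
    (νt : Ω → ℝ≥0) (ν : Ω → ℕ) (α c : ℝ) (γ : ℝ≥0 → ℝ) : Prop where
  measurable_νt : Measurable νt
  measurable_ν : Measurable ν
  mean_eq_one : ∫ ω, (ν ω : ℝ) ∂P = 1
  joint_tail : ∀ b : ℝ≥0,
    (fun r : ℝ => P.real {ω | r ≤ (νt ω : ℝ) ∧ (b : ℝ) * r ≤ (ν ω : ℝ)})
      ~[atTop] fun r : ℝ => γ b * r ^ (-α)
  tail : (fun r : ℝ => P.real {ω | r ≤ (ν ω : ℝ)}) ~[atTop] fun r : ℝ => c * r ^ (-α)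

/-- `(νt, ν)` satisfies the tail assumptions with parameters `α, c, γ`, and the nonnegative random
variable `M`, which may live on another probability space, solves the distributional equation
`M = max {νt, max_{k ≤ ν} M_k}`. -/
structure IsTailModel {Ω : Type u} [MeasurableSpace Ω] (P : Measure Ω) {Ω' : Type v}
    [MeasurableSpace Ω'] (P' : Measure Ω') [IsProbabilityMeasure P']
    (νt : Ω → ℝ≥0) (ν : Ω → ℕ) (M : Ω' → ℝ≥0) (α c : ℝ) (γ : ℝ≥0 → ℝ) : Prop where
  hasJointTail : HasJointTail P νt ν α c γ
  measurable_M : Measurable M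
  solves :
    haveI : IsProbabilityMeasure (P'.map M) :=
      Measure.isProbabilityMeasure_map measurable_M.aemeasurable
    IsMaxFixedPoint (P.map fun ω => (νt ω, ν ω)) (P'.map M)

open Set Topology

/-! Write `q = P(M ≤ r)`. Conditioning on `(νt, ν)` gives `q = E[q^ν; νt ≤ r]`, that is, `E[q^ν] - q
= E[q^ν; νt > r]`. Since `E[ν] = 1`, the left side is non-increasing in `q ∈ [0, 1]`, while the
right side is non-decreasing. Hence, if at a test point `e` the left side is strictly below (above)
the right side, then `q < e` (`q > e`). Only the asymptotics of both sides at the explicit points `e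
= exp (-(y * s r))` are needed, and no regularity of the law of `M` (`IsTailModel.tendsto_div`).

With `l = y * s r` and a common normalisation `a r`, the left side tends to some `K y` and the right
side to some `G y`; the constant is the point where `K` overtakes `G`. The left side comes from the
expansion of `E[exp (-l ν)] - exp (-l)` as `l → 0`: of order `l^α` for `1 < α < 2`, equivalent to `c
l² log (1/l)` for `α = 2`, and to `(E[ν²] - 1) l² / 2` for `α > 2`. On the right, `νt > r` has
probability of order `r^(-α)`. For `α < 2` the scale is `s r = 1/r`, so large `ν` and large `νt`
interact and all of `γ` enters. For `α ≥ 2`, `r * s r → 0`, so the factor `exp (-l ν)` is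
asymptotically harmless and only `P(νt > r)` remains. -/

/-! ### The functional equation and its monotonicity -/

theorem maxWith_le_iff (x t : ℝ≥0) (n : ℕ) (y : ℕ → ℝ≥0) :
    maxWith x n y ≤ t ↔ x ≤ t ∧ ∀ k ∈ Finset.range n, y k ≤ t := by
  simp [maxWith]

/-- The distribution function of a solution of the fixed-point equation. -/
theorem IsMaxFixedPoint.real_Iic {ρ : Measure (ℝ≥0 × ℕ)} [IsProbabilityMeasure ρ]
    {m : Measure ℝ≥0} [IsProbabilityMeasure m] (h : IsMaxFixedPoint ρ m) (t : ℝ≥0) :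
    m.real (Iic t) = ∫ p in {p | p.1 ≤ t}, m.real (Iic t) ^ p.2 ∂ρ := by
  have hms : MeasurableSet {p : ℝ≥0 × ℕ | p.1 ≤ t} := measurableSet_le measurable_fst measurable_const
  have key : m (Iic t) = ∫⁻ p in {p : ℝ≥0 × ℕ | p.1 ≤ t}, m (Iic t) ^ p.2 ∂ρ := by
    conv_lhs => rw [h, maxLaw]
    rw [Measure.map_apply measurable_maxWith measurableSet_Iic,
      Measure.prod_apply (measurable_maxWith measurableSet_Iic), ← lintegral_indicator hms]
    refine lintegral_congr fun p => ?_
    by_cases hp : p.1 ≤ t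
    · rw [indicator_of_mem (by exact hp)]
      -- For fixed `(x, n)` with `x ≤ t`, the event only constrains the first `n` coordinates, so
      -- its product measure is an `n`-th power.
      have : Prod.mk p ⁻¹' ((fun p : (ℝ≥0 × ℕ) × (ℕ → ℝ≥0) => maxWith p.1.1 p.1.2 p.2) ⁻¹' Iic t)
          = Set.pi (Finset.range p.2) (fun _ => Iic t) := by
        ext y
        simp [maxWith_le_iff, hp, Set.mem_pi]
      rw [this, Measure.infinitePi_pi _ (fun _ _ => measurableSet_Iic)]
      simp
    · rw [indicator_of_notMem (by exact hp)]
      have : Prod.mk p ⁻¹' ((fun p : (ℝ≥0 × ℕ) × (ℕ → ℝ≥0) => maxWith p.1.1 p.1.2 p.2) ⁻¹' Iic t)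
          = ∅ := by
        ext y
        simp [maxWith_le_iff, hp]
      rw [this, measure_empty]
  rw [integral_eq_lintegral_of_nonneg_ae (ae_of_all _ fun p => by positivity)
    (by
      have : Measurable fun n : ℕ => m.real (Iic t) ^ n := by fun_prop
      exact (this.comp measurable_snd).aestronglyMeasurable)]
  conv_lhs => rw [measureReal_def, key]
  congr 1
  refine lintegral_congr fun p => ?_
  rw [ENNReal.ofReal_pow measureReal_nonneg, measureReal_def,
    ENNReal.ofReal_toReal (measure_ne_top _ _)]

/-- A non-integrable function has Bochner integral `0`, not `1`. -/
theorem integrable_of_mean_eq_one {Ω : Type u} [MeasurableSpace Ω] {P : Measure Ω}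
    {ν : Ω → ℕ} (h : ∫ ω, (ν ω : ℝ) ∂P = 1) :
    Integrable (fun ω => (ν ω : ℝ)) P := by
  by_contra hc
  rw [integral_undef hc] at h
  simp at h

section Model

variable {Ω : Type u} [MeasurableSpace Ω] {P : Measure Ω} [IsProbabilityMeasure P]

theorem integrable_pow_natCast {ν : Ω → ℕ} (hν : Measurable ν) {q : ℝ} (h0 : 0 ≤ q) (h1 : q ≤ 1)
    (μ : Measure Ω) [IsFiniteMeasure μ] : Integrable (fun ω => q ^ ν ω) μ := by
  have : Measurable fun n : ℕ => q ^ n := by fun_prop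
  refine Integrable.of_bound (this.comp hν).aestronglyMeasurable 1 (ae_of_all _ fun ω => ?_)
  rw [Real.norm_of_nonneg (by positivity)]
  exact pow_le_one₀ h0 h1

/-- Subtract `q = E[q^ν; νt ≤ r]` from `E[q^ν]`. In this form the two sides have opposite
monotonicity in `q`, which is what the comparison argument uses. -/
theorem IsTailModel.functional_equation {Ω' : Type v} [MeasurableSpace Ω'] {P' : Measure Ω'}
    [IsProbabilityMeasure P'] {νt : Ω → ℝ≥0} {ν : Ω → ℕ} {M : Ω' → ℝ≥0} {α c : ℝ} {γ : ℝ≥0 → ℝ}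
    (h : IsTailModel P P' νt ν M α c γ) {r : ℝ} (hr : 0 ≤ r) :
    (∫ ω, (1 - P'.real {ω | r < (M ω : ℝ)}) ^ ν ω ∂P) - (1 - P'.real {ω | r < (M ω : ℝ)}) =
      ∫ ω in {ω | r < (νt ω : ℝ)}, (1 - P'.real {ω | r < (M ω : ℝ)}) ^ ν ω ∂P := by
  lift r to ℝ≥0 using hr
  have hνt := h.hasJointTail.measurable_νt
  have hν := h.hasJointTail.measurable_ν
  have : IsProbabilityMeasure (P'.map M) :=
    Measure.isProbabilityMeasure_map h.measurable_M.aemeasurable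
  have : IsProbabilityMeasure (P.map fun ω => (νt ω, ν ω)) :=
    Measure.isProbabilityMeasure_map (hνt.prodMk hν).aemeasurable
  have key := IsMaxFixedPoint.real_Iic h.solves r
  have hmM : MeasurableSet {ω | (r : ℝ) < (M ω : ℝ)} := by
    have := measurableSet_lt (measurable_const (a := r)) h.measurable_M
    simpa using this
  have hm : MeasurableSet {ω | (r : ℝ) < (νt ω : ℝ)} := by
    have := measurableSet_lt (measurable_const (a := r)) hνt
    simpa using this
  have hq : (P'.map M).real (Iic r) = 1 - P'.real {ω | (r : ℝ) < (M ω : ℝ)} := by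
    rw [map_measureReal_apply h.measurable_M measurableSet_Iic, ← probReal_compl_eq_one_sub hmM]
    congr 1
    ext ω
    simp
  rw [hq] at key
  set q := 1 - P'.real {ω | (r : ℝ) < (M ω : ℝ)} with hqd
  have hq0 : 0 ≤ q := by rw [← hq]; positivity
  have hq1 : q ≤ 1 := by rw [← hq]; exact measureReal_le_one
  have hms : MeasurableSet {p : ℝ≥0 × ℕ | p.1 ≤ r} := measurableSet_le measurable_fst measurable_const
  have hmeas : Measurable fun n : ℕ => q ^ n := by fun_prop
  rw [setIntegral_map (f := fun p : ℝ≥0 × ℕ => q ^ p.2) hms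
    (hmeas.comp measurable_snd).aestronglyMeasurable (hνt.prodMk hν).aemeasurable] at key
  have hset : ((fun ω => (νt ω, ν ω)) ⁻¹' {p : ℝ≥0 × ℕ | p.1 ≤ r})
      = {ω | (r : ℝ) < (νt ω : ℝ)}ᶜ := by
    ext ω
    simp
  rw [hset] at key
  have hadd := integral_add_compl hm (integrable_pow_natCast hν hq0 hq1 P)
  simp only at key
  linarith

theorem pow_sub_pow_le_natCast_mul {a b : ℝ} (ha : 0 ≤ a) (hab : a ≤ b) (hb : b ≤ 1) (n : ℕ) :
    b ^ n - a ^ n ≤ n * (b - a) := by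
  induction n with
  | zero => simp
  | succ n ih =>
    have h1 : b ^ n ≤ 1 := pow_le_one₀ (ha.trans hab) hb
    have h2 : a ^ n ≤ b ^ n := pow_le_pow_left₀ ha hab n
    have h3 : (0:ℝ) ≤ a ^ n := by positivity
    push_cast
    have : b ^ (n + 1) - a ^ (n + 1) = b ^ n * (b - a) + a * (b ^ n - a ^ n) := by ring
    rw [this]
    nlinarith

/-- The generating function of a variable of mean one has slope at most one on `[0, 1]`. -/
theorem integral_pow_sub_antitone {ν : Ω → ℕ} (hν : Measurable ν) (h : ∫ ω, (ν ω : ℝ) ∂P = 1)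
    {a b : ℝ} (ha : 0 ≤ a) (hab : a ≤ b) (hb : b ≤ 1) :
    (∫ ω, b ^ ν ω ∂P) - b ≤ (∫ ω, a ^ ν ω ∂P) - a := by
  have hib := integrable_pow_natCast hν (ha.trans hab) hb P
  have hia := integrable_pow_natCast hν ha (hab.trans hb) P
  have := integral_mono (hib.sub hia) ((integrable_of_mean_eq_one h).mul_const (b - a))
    (fun ω => pow_sub_pow_le_natCast_mul ha hab hb (ν ω))
  rw [integral_mul_const, h] at this
  simp only [Pi.sub_apply] at this
  rw [integral_sub hib hia] at this
  linarith

/-! ### Layer-cake representations of the generating function -/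

/-- Layer-cake formula for the integral of a primitive of a nonnegative continuous function. -/
theorem integral_primitive_comp_eq {μ : Measure Ω} [IsFiniteMeasure μ] {X : Ω → ℝ}
    (hX : Measurable X) (hX0 : ∀ ω, 0 ≤ X ω) {g : ℝ → ℝ} (hg : Continuous g)
    (hg0 : ∀ t, 0 < t → 0 ≤ g t) :
    ∫ ω, (∫ t in (0:ℝ)..X ω, g t) ∂μ = ∫ t in Ioi (0:ℝ), μ.real {ω | t < X ω} * g t := by
  have hprim : Continuous fun x : ℝ => ∫ t in (0:ℝ)..x, g t :=
    intervalIntegral.continuous_primitive (fun a b => hg.intervalIntegrable a b) 0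
  have hanti : Antitone fun t : ℝ => μ.real {ω | t < X ω} := fun s t hst =>
    measureReal_mono fun ω hω => hst.trans_lt hω
  rw [integral_eq_lintegral_of_nonneg_ae (ae_of_all _ fun ω => ?_)
      (show AEStronglyMeasurable (fun ω => ∫ t in (0:ℝ)..X ω, g t) μ from
        (hprim.measurable.comp hX).aestronglyMeasurable),
    integral_eq_lintegral_of_nonneg_ae, lintegral_comp_eq_lintegral_meas_lt_mul]
  · congr 1
    refine lintegral_congr fun t => ?_
    rw [ENNReal.ofReal_mul measureReal_nonneg, measureReal_def,
      ENNReal.ofReal_toReal (measure_ne_top _ _)]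
  · exact ae_of_all _ hX0
  · exact hX.aemeasurable
  · exact fun t _ => hg.intervalIntegrable _ _
  · exact (ae_restrict_iff' measurableSet_Ioi).2 (ae_of_all _ fun t ht => hg0 t ht)
  · exact (ae_restrict_iff' measurableSet_Ioi).2
      (ae_of_all _ fun t ht => mul_nonneg measureReal_nonneg (hg0 t ht))
  · exact (hanti.measurable.mul hg.measurable).aestronglyMeasurable
  · exact intervalIntegral.integral_nonneg_of_ae_restrict (hX0 ω)
      ((ae_restrict_iff' measurableSet_Icc).2 (by
        filter_upwards [Measure.ae_ne volume (0:ℝ)] with t ht0 ht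
        exact hg0 t (lt_of_le_of_ne ht.1 (Ne.symm ht0))))

theorem integral_exp_neg_interval (x : ℝ) :
    ∫ t in (0:ℝ)..x, Real.exp (-t) = 1 - Real.exp (-x) := by
  have := intervalIntegral.integral_eq_sub_of_hasDerivAt (a := 0) (b := x)
    (f := fun t => -Real.exp (-t)) (f' := fun t => Real.exp (-t))
    (fun t _ => by simpa using ((hasDerivAt_neg t).exp).fun_neg)
    ((by fun_prop : Continuous fun t : ℝ => Real.exp (-t)).intervalIntegrable _ _)
  rw [this]; simp; ring

theorem integral_one_sub_exp_neg_interval (x : ℝ) :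
    ∫ t in (0:ℝ)..x, (1 - Real.exp (-t)) = Real.exp (-x) - 1 + x := by
  rw [intervalIntegral.integral_sub (by simp)
    ((by fun_prop : Continuous fun t : ℝ => Real.exp (-t)).intervalIntegrable _ _),
    integral_exp_neg_interval]
  simp; ring

theorem exp_neg_pow (l : ℝ) (n : ℕ) : Real.exp (-l) ^ n = Real.exp (-(l * n)) := by
  rw [← Real.exp_nat_mul]; ring_nf

/-- Layer-cake formula for `1 - exp (-x)`, the primitive of `exp (-t)`, at `x = l ν`, under `P`
restricted to `A`. It brings in the joint tail. -/
theorem setIntegral_exp_neg_pow {ν : Ω → ℕ} (hν : Measurable ν) (A : Set Ω)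
    {l : ℝ} (hl : 0 < l) :
    ∫ ω in A, Real.exp (-l) ^ ν ω ∂P =
      P.real A - ∫ t in Ioi (0:ℝ), P.real (A ∩ {ω | t / l < ν ω}) * Real.exp (-t) := by
  have hX : Measurable fun ω => l * (ν ω : ℝ) := (measurable_from_nat.comp hν).const_mul l
  have h := integral_primitive_comp_eq (μ := P.restrict A) hX (fun ω => by positivity)
    (g := fun t => Real.exp (-t)) (by fun_prop) (fun t _ => (Real.exp_pos _).le)
  simp only [integral_exp_neg_interval, ← exp_neg_pow] at h
  rw [integral_sub (integrable_const _)
    (integrable_pow_natCast hν (Real.exp_pos _).le (by simp [hl.le]) _)] at h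
  simp only [integral_const, smul_eq_mul, mul_one, measureReal_restrict_apply_univ] at h
  have : ∀ t, (P.restrict A).real {ω | t < l * (ν ω : ℝ)} = P.real (A ∩ {ω | t / l < ν ω}) := by
    intro t
    rw [measureReal_restrict_apply (measurableSet_lt measurable_const hX), inter_comm]
    congr 2
    ext ω
    simp only [mem_ofPred_eq]
    rw [div_lt_iff₀ hl, mul_comm]
  simp only [this] at h
  linarith

/-- Layer-cake formula for `exp (-x) - 1 + x`, the primitive of `1 - exp (-t)`; the linear term
integrates to `l` because the mean is one. -/
theorem integral_exp_neg_pow_sub {ν : Ω → ℕ} (hν : Measurable ν) (h1 : ∫ ω, (ν ω : ℝ) ∂P = 1)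
    {l : ℝ} (hl : 0 < l) :
    (∫ ω, Real.exp (-l) ^ ν ω ∂P) - 1 + l =
      ∫ t in Ioi (0:ℝ), P.real {ω | t / l < ν ω} * (1 - Real.exp (-t)) := by
  have hX : Measurable fun ω => l * (ν ω : ℝ) := (measurable_from_nat.comp hν).const_mul l
  have h := integral_primitive_comp_eq (μ := P) hX (fun ω => by positivity)
    (g := fun t => 1 - Real.exp (-t)) (by fun_prop) (fun t ht => by simp [ht.le])
  simp only [integral_one_sub_exp_neg_interval, ← exp_neg_pow] at h
  have hi := integrable_pow_natCast hν (Real.exp_pos (-l)).le (by simp [hl.le]) P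
  rw [integral_add (f := fun ω => Real.exp (-l) ^ ν ω - 1) (hi.sub (integrable_const _)) ((integrable_of_mean_eq_one h1).const_mul l),
    integral_sub hi (integrable_const _), integral_const_mul, h1] at h
  simp only [integral_const, smul_eq_mul, mul_one, probReal_univ] at h
  rw [h]
  congr 1
  ext t
  congr 3
  ext ω
  rw [div_lt_iff₀ hl, mul_comm]

end Model

/-! ### Comparison principle -/

section Model

variable {Ω : Type u} [MeasurableSpace Ω] {P : Measure Ω} [IsProbabilityMeasure P]

/-- Comparison of a solution of the functional equation with the curves `exp (-(y * s r))`. -/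
theorem IsTailModel.tendsto_div {Ω' : Type v} [MeasurableSpace Ω'] {P' : Measure Ω'}
    [IsProbabilityMeasure P'] {νt : Ω → ℝ≥0} {ν : Ω → ℕ} {M : Ω' → ℝ≥0} {α c : ℝ} {γ : ℝ≥0 → ℝ}
    (h : IsTailModel P P' νt ν M α c γ) {s a K G : ℝ → ℝ} {C : ℝ} (hC : 0 < C)
    (hs : ∀ᶠ r in atTop, 0 < s r) (hs0 : Tendsto s atTop (𝓝 0)) (ha : ∀ᶠ r in atTop, 0 < a r)
    (hK : ∀ y, 0 < y → Tendsto (fun r => ((∫ ω, Real.exp (-(y * s r)) ^ ν ω ∂P)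
      - Real.exp (-(y * s r))) / a r) atTop (𝓝 (K y)))
    (hG : ∀ y, 0 < y → Tendsto (fun r => (∫ ω in {ω | r < (νt ω : ℝ)},
      Real.exp (-(y * s r)) ^ ν ω ∂P) / a r) atTop (𝓝 (G y)))
    (hlt : ∀ y, 0 < y → y < C → K y < G y) (hgt : ∀ y, C < y → G y < K y) :
    Tendsto (fun r => P'.real {ω | r < (M ω : ℝ)} / s r) atTop (𝓝 C) := by
  have hν := h.hasJointTail.measurable_ν
  have hmean := h.hasJointTail.mean_eq_one
  -- `1 - exp (-(y * s r))` is asymptotic to `y * s r`, so bounds of `P(M > r)` by test points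
  -- become bounds of the ratio by `y`.
  have hslope : ∀ y : ℝ, Tendsto (fun r => (1 - Real.exp (-(y * s r))) / s r) atTop (𝓝 y) := by
    intro y
    have hd : HasDerivAt (fun x : ℝ => 1 - Real.exp (-(y * x))) y 0 := by
      have h1 : HasDerivAt (fun x : ℝ => -(y * x)) (-y) 0 := by
        simpa using ((hasDerivAt_id (0:ℝ)).const_mul y).fun_neg
      simpa using h1.exp.const_sub 1
    have := (hasDerivAt_iff_tendsto_slope.1 hd).comp
      (tendsto_nhdsWithin_iff.2 ⟨hs0, hs.mono fun r hr => (ne_of_gt hr : s r ≠ 0)⟩)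
    refine this.congr fun r => ?_
    simp [slope_def_field]
  have hmono : ∀ (r : ℝ) {p q : ℝ}, 0 ≤ p → p ≤ q → q ≤ 1 →
      ∫ ω in {ω | r < (νt ω : ℝ)}, p ^ ν ω ∂P ≤ ∫ ω in {ω | r < (νt ω : ℝ)}, q ^ ν ω ∂P :=
    fun r p q hp hpq hq => integral_mono (integrable_pow_natCast hν hp (hpq.trans hq) _)
      (integrable_pow_natCast hν (hp.trans hpq) hq _) fun ω => pow_le_pow_left₀ hp hpq _
  have hq0 : ∀ r : ℝ, 0 ≤ 1 - P'.real {ω | r < (M ω : ℝ)} := fun r => by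
    have : P'.real {ω | r < (M ω : ℝ)} ≤ 1 := measureReal_le_one
    linarith
  have hq1 : ∀ r : ℝ, 1 - P'.real {ω | r < (M ω : ℝ)} ≤ 1 := fun r => by
    have : 0 ≤ P'.real {ω | r < (M ω : ℝ)} := measureReal_nonneg
    linarith
  rw [tendsto_order]
  constructor
  · intro b hb
    obtain ⟨y, hy, hyC⟩ := exists_between (max_lt hb hC)
    have hy0 : 0 < y := (le_max_right _ _).trans_lt hy
    have hyb : b < y := (le_max_left _ _).trans_lt hy
    filter_upwards [hs, ha, (hslope y).eventually_const_lt hyb, eventually_ge_atTop 0,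
      (hK y hy0).eventually_lt (hG y hy0) (hlt y hy0 hyC)] with r hsr har hsl hr hcmp
    refine hsl.trans ?_
    rw [div_lt_div_iff_of_pos_right har] at hcmp
    rw [div_lt_div_iff_of_pos_right hsr]
    -- Otherwise `exp (-(y * s r)) ≤ q`; passing from the test point to `q` lowers the left side and
    -- raises the right side, so the strict inequality `hcmp` persists at `q` and contradicts the
    -- functional equation.
    by_contra! hle
    have heq := h.functional_equation hr
    have h1 := integral_pow_sub_antitone hν hmean (Real.exp_pos (-(y * s r))).le
      (by linarith : Real.exp (-(y * s r)) ≤ 1 - P'.real {ω | r < (M ω : ℝ)}) (hq1 r)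
    have h2 := hmono r (Real.exp_pos (-(y * s r))).le
      (by linarith : Real.exp (-(y * s r)) ≤ 1 - P'.real {ω | r < (M ω : ℝ)}) (hq1 r)
    linarith
  · intro b hb
    obtain ⟨y, hyC, hyb⟩ := exists_between hb
    have hy0 : 0 < y := hC.trans hyC
    filter_upwards [hs, ha, (hslope y).eventually_lt_const hyb, eventually_ge_atTop 0,
      (hG y hy0).eventually_lt (hK y hy0) (hgt y hyC)] with r hsr har hsl hr hcmp
    refine lt_trans ?_ hsl
    rw [div_lt_div_iff_of_pos_right har] at hcmp
    rw [div_lt_div_iff_of_pos_right hsr]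
    by_contra! hle
    have heq := h.functional_equation hr
    have he1 : Real.exp (-(y * s r)) ≤ 1 := by simp; positivity
    have h1 := integral_pow_sub_antitone hν hmean (hq0 r)
      (by linarith : 1 - P'.real {ω | r < (M ω : ℝ)} ≤ Real.exp (-(y * s r))) he1
    have h2 := hmono r (hq0 r)
      (by linarith : 1 - P'.real {ω | r < (M ω : ℝ)} ≤ Real.exp (-(y * s r))) he1
    linarith

/-! ### Regularly varying tails -/

theorem tendsto_rpow_mul_of_isEquivalent {F : ℝ → ℝ} {α C : ℝ}
    (h : F ~[atTop] fun r : ℝ => C * r ^ (-α)) : Tendsto (fun r => r ^ α * F r) atTop (𝓝 C) := by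
  have h1 : (fun r : ℝ => r ^ α * F r) ~[atTop] fun r => r ^ α * (C * r ^ (-α)) :=
    IsEquivalent.refl.mul h
  refine h1.symm.tendsto_nhds (tendsto_const_nhds.congr' ?_)
  filter_upwards [eventually_gt_atTop 0] with r hr
  rw [mul_left_comm, ← Real.rpow_add hr]
  simp

/-- The passage from non-strict to strict inequalities in regularly varying tails. -/
theorem tendsto_rpow_mul_of_squeeze {F F' : ℝ → ℝ} {α C : ℝ}
    (h : F ~[atTop] fun r : ℝ => C * r ^ (-α)) (hle : ∀ r, 0 < r → F' r ≤ F r)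
    (hge : ∀ k r, 1 < k → 0 < r → F (k * r) ≤ F' r) :
    Tendsto (fun r => r ^ α * F' r) atTop (𝓝 C) := by
  have hF := tendsto_rpow_mul_of_isEquivalent h
  rw [tendsto_order]
  constructor
  · intro b hb
    -- `r^α F(k r)` tends to `k^(-α) C`, which is still above `b` when `k > 1` is close to `1`.
    have hcont : Tendsto (fun k : ℝ => k ^ (-α) * C) (𝓝[>] 1) (𝓝 C) := by
      have : ContinuousAt (fun k : ℝ => k ^ (-α) * C) 1 :=
        (Real.continuousAt_rpow_const _ _ (Or.inl one_ne_zero)).mul continuousAt_const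
      have := this.tendsto.mono_left (nhdsWithin_le_nhds (s := Ioi 1))
      simpa using this
    obtain ⟨k, hkb, hk⟩ := ((hcont.eventually_const_lt hb).and self_mem_nhdsWithin).exists
    have hk1 : (1:ℝ) < k := hk
    have hk0 : (0:ℝ) < k := zero_lt_one.trans hk1
    have h1 := (hF.comp (tendsto_id.const_mul_atTop hk0)).const_mul (k ^ (-α))
    filter_upwards [h1.eventually_const_lt hkb, eventually_gt_atTop 0] with r hr hr0
    refine hr.trans_le ?_
    have : k ^ (-α) * ((k * r) ^ α * F (k * r)) = r ^ α * F (k * r) := by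
      rw [Real.mul_rpow hk0.le hr0.le, ← mul_assoc, ← mul_assoc, ← Real.rpow_add hk0]
      simp
    simp only [Function.comp, id]
    rw [this]
    exact mul_le_mul_of_nonneg_left (hge k r hk1 hr0) (by positivity)
  · intro b hb
    filter_upwards [hF.eventually_lt_const hb, eventually_gt_atTop 0] with r hr hr0
    exact (mul_le_mul_of_nonneg_left (hle r hr0) (by positivity)).trans_lt hr

namespace HasJointTail

variable {νt : Ω → ℝ≥0} {ν : Ω → ℕ} {α c : ℝ} {γ : ℝ≥0 → ℝ}

theorem tendsto_tail (h : HasJointTail P νt ν α c γ) :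
    Tendsto (fun r : ℝ => r ^ α * P.real {ω | r < (ν ω : ℝ)}) atTop (𝓝 c) := by
  refine tendsto_rpow_mul_of_squeeze h.tail (fun r _ => measureReal_mono fun ω hω => ?_)
    (fun k r hk hr => measureReal_mono fun ω hω => ?_)
  · have : r < ν ω := hω
    exact this.le
  · have : k * r ≤ ν ω := hω
    show r < ν ω
    nlinarith

theorem tendsto_first_tail (h : HasJointTail P νt ν α c γ) :
    Tendsto (fun r : ℝ => r ^ α * P.real {ω | r < (νt ω : ℝ)}) atTop (𝓝 (γ 0)) := by
  refine tendsto_rpow_mul_of_squeeze (h.joint_tail 0) (fun r _ => measureReal_mono fun ω hω => ?_)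
    (fun k r hk hr => measureReal_mono fun ω hω => ?_)
  · have : r < νt ω := hω
    exact ⟨this.le, by simp⟩
  · have : k * r ≤ νt ω := hω.1
    show r < νt ω
    nlinarith

theorem tendsto_joint_tail (h : HasJointTail P νt ν α c γ) {b : ℝ≥0} (hb : 0 < b) :
    Tendsto (fun r : ℝ => r ^ α * P.real ({ω | r < (νt ω : ℝ)} ∩ {ω | (b : ℝ) * r < ν ω})) atTop
      (𝓝 (γ b)) := by
  have hb' : (0 : ℝ) < b := hb
  refine tendsto_rpow_mul_of_squeeze (h.joint_tail b) (fun r _ => measureReal_mono fun ω hω => ?_)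
    (fun k r hk hr => measureReal_mono fun ω hω => ?_)
  · have h1 : r < νt ω := hω.1
    have h2 : b * r < ν ω := hω.2
    exact ⟨h1.le, h2.le⟩
  · have h1 : k * r ≤ νt ω := hω.1
    have h2 : b * (k * r) ≤ ν ω := hω.2
    refine ⟨show r < νt ω by nlinarith, show b * r < ν ω from ?_⟩
    nlinarith [mul_pos hb' hr]

theorem exists_tail_bound (h : HasJointTail P νt ν α c γ) (hα : 0 < α) :
    ∃ D : ℝ, 0 < D ∧ ∀ t : ℝ, 0 < t → P.real {ω | t < (ν ω : ℝ)} ≤ D * t ^ (-α) := by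
  obtain ⟨A, hA⟩ := eventually_atTop.1
    (h.tendsto_tail.eventually_le_const (lt_add_one c))
  have hA1 : (0:ℝ) < max A 1 := by positivity
  -- Beyond the threshold the limit gives `c + 1`; below it the probability is at most `1` and `t^α
  -- ≤ (max A 1)^α`.
  refine ⟨max (c + 1) (max A 1 ^ α), lt_max_of_lt_right (by positivity), fun t ht => ?_⟩
  rw [Real.rpow_neg ht.le, ← div_eq_mul_inv, le_div_iff₀ (by positivity)]
  rcases le_total (max A 1) t with h1 | h1
  · rw [mul_comm]
    exact (hA t ((le_max_left _ _).trans h1)).trans (le_max_left _ _)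
  · refine le_trans ?_ (le_max_right _ _)
    calc _ ≤ 1 * t ^ α := by gcongr; exact measureReal_le_one
      _ ≤ _ := by rw [one_mul]; exact Real.rpow_le_rpow ht.le h1 hα.le

/-- Discard the event `νt > r` and compare with the tail of `ν` at level `b r`. The bound forces `γ`
to vanish at infinity, hence to be non-constant. -/
theorem gamma_le (h : HasJointTail P νt ν α c γ) {b : ℝ≥0} (hb : 0 < b) :
    γ b ≤ c * (b : ℝ) ^ (-α) := by
  have hb' : (0 : ℝ) < b := hb
  have h1 := (h.tendsto_tail.comp (tendsto_id.const_mul_atTop hb')).mul_const ((b : ℝ) ^ (-α))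
  refine le_of_tendsto_of_tendsto (h.tendsto_joint_tail hb) h1 ?_
  filter_upwards [eventually_gt_atTop 0] with r hr
  have : ((b:ℝ) * r) ^ α * P.real {ω | b * r < ν ω} * (b:ℝ) ^ (-α)
      = r ^ α * P.real {ω | b * r < ν ω} := by
    rw [Real.mul_rpow hb'.le hr.le]
    have : (b:ℝ) ^ α * (b:ℝ) ^ (-α) = 1 := by rw [← Real.rpow_add hb']; simp
    linear_combination (r ^ α * P.real {ω | b * r < ν ω}) * this
  simp only [Function.comp, id]
  rw [this]
  exact mul_le_mul_of_nonneg_left (measureReal_mono inter_subset_right) (by positivity)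

/-- Asymptotics of the right-hand side of the functional equation. -/
theorem tendsto_setIntegral_exp (h : HasJointTail P νt ν α c γ) {l g : ℝ → ℝ}
    (hl : ∀ᶠ r in atTop, 0 < l r)
    (hg : ∀ t, 0 < t → Tendsto (fun r : ℝ => r ^ α *
      P.real ({ω | r < (νt ω : ℝ)} ∩ {ω | t / l r < ν ω})) atTop (𝓝 (g t))) :
    Tendsto (fun r : ℝ => r ^ α * ∫ ω in {ω | r < (νt ω : ℝ)}, Real.exp (-l r) ^ ν ω ∂P) atTop
      (𝓝 (γ 0 - ∫ t in Ioi (0:ℝ), g t * Real.exp (-t))) := by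
  have hint : Tendsto (fun r : ℝ => ∫ t in Ioi (0:ℝ), r ^ α *
      P.real ({ω | r < (νt ω : ℝ)} ∩ {ω | t / l r < ν ω}) * Real.exp (-t)) atTop
      (𝓝 (∫ t in Ioi (0:ℝ), g t * Real.exp (-t))) := by
    -- The joint probability is at most `P(νt > r)`, and `r^α P(νt > r)` is eventually at most `γ 0
    -- + 1`.
    refine tendsto_integral_filter_of_dominated_convergence
      (fun t => (γ 0 + 1) * Real.exp (-t)) ?_ ?_ ?_ ?_
    · filter_upwards [hl] with r hr
      have hanti : Antitone fun t : ℝ =>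
          P.real ({ω | r < (νt ω : ℝ)} ∩ {ω | t / l r < ν ω}) := fun s t hst =>
        measureReal_mono (inter_subset_inter_right _ fun ω hω =>
          (div_le_div_of_nonneg_right hst hr.le).trans_lt hω)
      exact ((hanti.measurable.const_mul _).mul (by fun_prop)).aestronglyMeasurable
    · filter_upwards [h.tendsto_first_tail.eventually_le_const (lt_add_one _),
        eventually_gt_atTop 0] with r hr hr0
      refine ae_of_all _ fun t => ?_
      rw [Real.norm_of_nonneg (by positivity)]
      refine mul_le_mul_of_nonneg_right (le_trans ?_ hr) (Real.exp_pos _).le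
      exact mul_le_mul_of_nonneg_left (measureReal_mono inter_subset_left) (by positivity)
    · exact (integrableOn_exp_neg_Ioi 0).const_mul _
    · exact (ae_restrict_iff' measurableSet_Ioi).2 (ae_of_all _ fun t ht =>
        (hg t ht).mul_const _)
  refine (h.tendsto_first_tail.sub hint).congr' ?_
  filter_upwards [hl] with r hr
  rw [setIntegral_exp_neg_pow h.measurable_ν _ hr, mul_sub, ← integral_const_mul]
  simp only [mul_assoc]

end HasJointTail

end Model

/-! ### Elementary estimates for the exponential -/

theorem exp_neg_sub_one_add_nonneg (x : ℝ) : 0 ≤ Real.exp (-x) - 1 + x := by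
  linarith [Real.one_sub_le_exp_neg x]

theorem exp_neg_sub_one_add_le_sq {x : ℝ} (hx : 0 ≤ x) : Real.exp (-x) - 1 + x ≤ x ^ 2 := by
  rcases le_total x 1 with h | h
  · have := Real.abs_exp_sub_one_sub_id_le (x := -x) (by rwa [abs_neg, abs_of_nonneg hx])
    have := (abs_le.1 this).2
    linarith
  · have : Real.exp (-x) ≤ 1 := by simpa using hx
    nlinarith

theorem tendsto_exp_neg_sub_one_add_div_sq :
    Tendsto (fun x : ℝ => (Real.exp (-x) - 1 + x) / x ^ 2) (𝓝[>] 0) (𝓝 (1 / 2)) := by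
  rw [tendsto_iff_norm_sub_tendsto_zero]
  have hlim : Tendsto (fun x : ℝ => x) (𝓝[>] 0) (𝓝 0) := nhdsWithin_le_nhds
  refine squeeze_zero' (Eventually.of_forall fun _ => norm_nonneg _) ?_ hlim
  filter_upwards [Ioo_mem_nhdsGT (zero_lt_one' ℝ)] with x hx
  have hb := Real.exp_bound (x := -x) (n := 3)
    (by rw [abs_neg, abs_of_pos hx.1]; exact hx.2.le) (by norm_num)
  simp only [Finset.sum_range_succ, Finset.sum_range_zero, abs_neg, abs_of_pos hx.1] at hb
  norm_num [Nat.factorial] at hb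
  have hx2 : 0 < x ^ 2 := pow_pos hx.1 2
  have hx0 : x ≠ 0 := hx.1.ne'
  have : (Real.exp (-x) - 1 + x) / x ^ 2 - 1 / 2
      = (Real.exp (-x) - (1 + -x + x ^ 2 / 2)) / x ^ 2 := by
    field_simp; ring
  rw [this, Real.norm_eq_abs, abs_div, abs_of_pos hx2, div_le_iff₀ hx2]
  refine hb.trans ?_
  have : 0 < x ^ 3 := pow_pos hx.1 3
  nlinarith

theorem one_sub_exp_neg_le (x : ℝ) : 1 - Real.exp (-x) ≤ x := by
  linarith [Real.one_sub_le_exp_neg x]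

theorem tendsto_one_sub_exp_neg_div :
    Tendsto (fun x : ℝ => (1 - Real.exp (-x)) / x) (𝓝[>] 0) (𝓝 1) := by
  have hd : HasDerivAt (fun x : ℝ => 1 - Real.exp (-x)) 1 0 := by
    simpa using ((hasDerivAt_neg (0:ℝ)).exp.const_sub 1)
  have := (hasDerivAt_iff_tendsto_slope.1 hd).mono_left
    (nhdsWithin_mono (0:ℝ) (fun x (hx : 0 < x) => ne_of_gt hx) : 𝓝[>] (0:ℝ) ≤ _)
  refine this.congr fun x => ?_
  simp [slope_def_field]

theorem integrable_exp_neg_abs_real : Integrable fun u : ℝ => Real.exp (-|u|) := by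
  rw [← integrableOn_univ, ← Iic_union_Ioi (a := (0:ℝ))]
  refine IntegrableOn.union ?_ ?_
  · refine (integrableOn_exp_Iic 0).congr_fun (fun u hu => ?_) measurableSet_Iic
    simp [abs_of_nonpos (show u ≤ 0 from hu)]
  · refine (integrableOn_exp_neg_Ioi 0).congr_fun (fun u hu => ?_) measurableSet_Ioi
    simp [abs_of_pos (show 0 < u from hu)]

/-- The function `(1 - exp (-t)) t ^ (-α)` is integrable on the half-line for `1 < α < 2`. -/
theorem integrableOn_rpow_neg_mul_one_sub_exp {α : ℝ} (h1 : 1 < α) (h2 : α < 2) :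
    IntegrableOn (fun t : ℝ => t ^ (-α) * (1 - Real.exp (-t))) (Ioi 0) := by
  have hmeas : AEStronglyMeasurable (fun t : ℝ => t ^ (-α) * (1 - Real.exp (-t))) :=
    ((measurable_id.pow_const _).mul (by fun_prop)).aestronglyMeasurable
  rw [← Ioc_union_Ioi_eq_Ioi (zero_le_one' ℝ)]
  refine IntegrableOn.union ?_ ?_
  · have hi : IntegrableOn (fun t : ℝ => t ^ (1 - α)) (Ioc 0 1) := by
      rw [← intervalIntegrable_iff_integrableOn_Ioc_of_le zero_le_one]
      exact intervalIntegral.intervalIntegrable_rpow' (by linarith)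
    refine hi.mono' hmeas.restrict ((ae_restrict_iff' measurableSet_Ioc).2
      (ae_of_all _ fun t ht => ?_))
    have hp : 0 ≤ 1 - Real.exp (-t) := by simp [ht.1.le]
    rw [Real.norm_of_nonneg (mul_nonneg (Real.rpow_nonneg ht.1.le _) hp)]
    calc t ^ (-α) * (1 - Real.exp (-t)) ≤ t ^ (-α) * t := by
          gcongr
          · exact Real.rpow_nonneg ht.1.le _
          · exact one_sub_exp_neg_le t
      _ = t ^ (1 - α) := by
          rw [← Real.rpow_add_one ht.1.ne']; ring_nf
  · refine (integrableOn_Ioi_rpow_of_lt (a := -α) (by linarith) zero_lt_one).mono' hmeas.restrict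
      ((ae_restrict_iff' measurableSet_Ioi).2 (ae_of_all _ fun t ht => ?_))
    have ht0 : (0:ℝ) < t := zero_lt_one.trans ht
    have hp : 0 ≤ 1 - Real.exp (-t) := by simp [ht0.le]
    rw [Real.norm_of_nonneg (mul_nonneg (Real.rpow_nonneg ht0.le _) hp)]
    exact mul_le_of_le_one_right (Real.rpow_nonneg ht0.le _) (by linarith [Real.exp_pos (-t)])

theorem integral_rpow_neg_mul_one_sub_exp_pos {α : ℝ} (h1 : 1 < α) (h2 : α < 2) :
    0 < ∫ t in Ioi (0:ℝ), t ^ (-α) * (1 - Real.exp (-t)) := by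
  have hpos : ∀ t : ℝ, 0 < t → 0 < t ^ (-α) * (1 - Real.exp (-t)) := fun t ht =>
    mul_pos (Real.rpow_pos_of_pos ht _) (by simp [ht])
  rw [setIntegral_pos_iff_support_of_nonneg_ae
    ((ae_restrict_iff' measurableSet_Ioi).2 (ae_of_all _ fun t ht => (hpos t ht).le))
    (integrableOn_rpow_neg_mul_one_sub_exp h1 h2)]
  have : Function.support (fun t : ℝ => t ^ (-α) * (1 - Real.exp (-t))) ∩ Ioi 0 = Ioi 0 :=
    inter_eq_right.2 fun t ht => (hpos t ht).ne'
  rw [this]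
  simp

/-! ### The generating function near one -/

section Model

variable {Ω : Type u} [MeasurableSpace Ω] {P : Measure Ω} [IsProbabilityMeasure P]

theorem antitone_tail (ν : Ω → ℕ) : Antitone fun t : ℝ => P.real {ω | t < (ν ω : ℝ)} :=
  fun _ _ hst => measureReal_mono fun _ hω => lt_of_le_of_lt hst hω

namespace HasJointTail

variable {νt : Ω → ℝ≥0} {ν : Ω → ℕ} {α c : ℝ} {γ : ℝ≥0 → ℝ}

/-- In the layer-cake integral, `P(ν > t/l) / l^α` tends to `c t^(-α)` and is at most `D t^(-α)`,
which is integrable against `1 - exp (-t)` for `1 < α < 2`. Replacing `1 - l` by `exp (-l)` costs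
`O(l²) = o(l^α)`. -/
theorem tendsto_generating_of_lt_two (h : HasJointTail P νt ν α c γ) (h1 : 1 < α) (h2 : α < 2) :
    Tendsto (fun l : ℝ => ((∫ ω, Real.exp (-l) ^ ν ω ∂P) - Real.exp (-l)) / l ^ α) (𝓝[>] 0)
      (𝓝 (c * ∫ t in Ioi (0:ℝ), t ^ (-α) * (1 - Real.exp (-t)))) := by
  obtain ⟨D, hD, hbound⟩ := h.exists_tail_bound (by linarith)
  have hpos : ∀ᶠ l : ℝ in 𝓝[>] 0, 0 < l := self_mem_nhdsWithin
  have hmain : Tendsto (fun l : ℝ => ∫ t in Ioi (0:ℝ),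
      P.real {ω | t / l < ν ω} / l ^ α * (1 - Real.exp (-t))) (𝓝[>] 0)
      (𝓝 (∫ t in Ioi (0:ℝ), c * (t ^ (-α) * (1 - Real.exp (-t))))) := by
    refine tendsto_integral_filter_of_dominated_convergence
      (fun t => D * (t ^ (-α) * (1 - Real.exp (-t)))) ?_ ?_ ?_ ?_
    · filter_upwards [hpos] with l hl
      exact ((((antitone_tail (P := P) ν).measurable.comp (measurable_id.div_const l)).div_const
        _).mul (by fun_prop)).aestronglyMeasurable
    · filter_upwards [hpos] with l hl
      refine (ae_restrict_iff' measurableSet_Ioi).2 (ae_of_all _ fun t ht => ?_)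
      have ht0 : (0:ℝ) < t := ht
      have hp : 0 ≤ 1 - Real.exp (-t) := by simp [ht0.le]
      rw [Real.norm_of_nonneg (by positivity), ← mul_assoc]
      refine mul_le_mul_of_nonneg_right ?_ hp
      rw [div_le_iff₀ (by positivity)]
      refine (hbound _ (by positivity)).trans_eq ?_
      rw [Real.div_rpow ht0.le hl.le, Real.rpow_neg hl.le, div_inv_eq_mul]
      ring
    · exact (integrableOn_rpow_neg_mul_one_sub_exp h1 h2).const_mul _
    · refine (ae_restrict_iff' measurableSet_Ioi).2 (ae_of_all _ fun t ht => ?_)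
      have ht0 : (0:ℝ) < t := ht
      have hdiv : Tendsto (fun l : ℝ => t / l) (𝓝[>] 0) atTop :=
        tendsto_inv_nhdsGT_zero.const_mul_atTop ht0
      have := ((h.tendsto_tail.comp hdiv).mul_const (t ^ (-α))).mul_const (1 - Real.exp (-t))
      rw [← mul_assoc]
      refine this.congr' ?_
      filter_upwards [hpos] with l hl
      simp only [Function.comp]
      rw [Real.div_rpow ht0.le hl.le]
      have : t ^ α * t ^ (-α) = 1 := by rw [← Real.rpow_add ht0]; simp
      field_simp
      linear_combination ((1 - Real.exp (-t)) * P.real {ω | t < l * ν ω}) * this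
  have hrem : Tendsto (fun l : ℝ => (Real.exp (-l) - 1 + l) / l ^ α) (𝓝[>] 0) (𝓝 0) := by
    have hz : Tendsto (fun l : ℝ => l ^ (2 - α)) (𝓝[>] 0) (𝓝 0) := by
      have := (Real.continuousAt_rpow_const (0:ℝ) (2 - α) (Or.inr (by linarith))).tendsto.mono_left
        (nhdsWithin_le_nhds (s := Ioi 0))
      rwa [Real.zero_rpow (by linarith)] at this
    have := tendsto_exp_neg_sub_one_add_div_sq.mul hz
    rw [mul_zero] at this
    refine this.congr' ?_
    filter_upwards [hpos] with l hl
    rw [Real.rpow_sub hl, Real.rpow_two]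
    field_simp
  have := hmain.sub hrem
  rw [integral_const_mul, sub_zero] at this
  refine this.congr' ?_
  filter_upwards [hpos] with l hl
  have e := integral_exp_neg_pow_sub h.measurable_ν h.mean_eq_one hl
  have : ∫ t in Ioi (0:ℝ), P.real {ω | t / l < ν ω} / l ^ α * (1 - Real.exp (-t))
      = (∫ t in Ioi (0:ℝ), P.real {ω | t / l < ν ω} * (1 - Real.exp (-t))) / l ^ α := by
    rw [← integral_div]
    congr 1
    ext t
    ring
  rw [this, ← e, ← sub_div]
  congr 1
  ring

/-- Second-order Taylor expansion under the expectation, dominated by `ν²` through `exp (-x) - 1 + x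
≤ x²`. The same expansion with `ν` replaced by `1` accounts for the `-1`. -/
theorem tendsto_generating_of_integrable_sq (h : HasJointTail P νt ν α c γ)
    (hi : Integrable (fun ω => (ν ω : ℝ) ^ 2) P) :
    Tendsto (fun l : ℝ => ((∫ ω, Real.exp (-l) ^ ν ω ∂P) - Real.exp (-l)) / l ^ 2) (𝓝[>] 0)
      (𝓝 (((∫ ω, (ν ω : ℝ) ^ 2 ∂P) - 1) / 2)) := by
  have hpos : ∀ᶠ l : ℝ in 𝓝[>] 0, 0 < l := self_mem_nhdsWithin
  have hνm : Measurable fun ω => (ν ω : ℝ) := measurable_from_nat.comp h.measurable_ν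
  have hmain : Tendsto (fun l : ℝ => ∫ ω, (Real.exp (-(l * ν ω)) - 1 + l * ν ω) / l ^ 2 ∂P)
      (𝓝[>] 0) (𝓝 (∫ ω, (ν ω : ℝ) ^ 2 * (1 / 2) ∂P)) := by
    refine tendsto_integral_filter_of_dominated_convergence
      (fun ω => (ν ω : ℝ) ^ 2) ?_ ?_ hi ?_
    · refine Eventually.of_forall fun l => Measurable.aestronglyMeasurable ?_
      fun_prop
    · filter_upwards [hpos] with l hl
      refine ae_of_all _ fun ω => ?_
      rw [Real.norm_of_nonneg (div_nonneg (exp_neg_sub_one_add_nonneg _) (by positivity)),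
        div_le_iff₀ (by positivity)]
      refine (exp_neg_sub_one_add_le_sq (by positivity)).trans_eq (by ring)
    · refine ae_of_all _ fun ω => ?_
      rcases Nat.eq_zero_or_pos (ν ω) with h0 | h0
      · simp [h0]
      · have hn : (0:ℝ) < ν ω := by exact_mod_cast h0
        have hl0 : Tendsto (fun l : ℝ => l * ν ω) (𝓝[>] 0) (𝓝[>] 0) := by
          refine tendsto_nhdsWithin_iff.2 ⟨?_, ?_⟩
          · have : Tendsto (fun l : ℝ => l * ν ω) (𝓝 0) (𝓝 (0 * ν ω)) := tendsto_id.mul_const _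
            rw [zero_mul] at this
            exact this.mono_left nhdsWithin_le_nhds
          · filter_upwards [hpos] with l hl
            exact mul_pos hl hn
        refine ((tendsto_exp_neg_sub_one_add_div_sq.comp hl0).const_mul ((ν ω : ℝ) ^ 2)).congr' ?_
        filter_upwards [hpos] with l hl
        simp only [Function.comp]
        field_simp
  have := hmain.sub tendsto_exp_neg_sub_one_add_div_sq
  rw [integral_mul_const] at this
  have e : (∫ ω, (ν ω : ℝ) ^ 2 ∂P) * (1 / 2) - 1 / 2 = ((∫ ω, (ν ω : ℝ) ^ 2 ∂P) - 1) / 2 := by ring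
  rw [e] at this
  refine this.congr' ?_
  filter_upwards [hpos] with l hl
  have hip := integrable_pow_natCast h.measurable_ν (Real.exp_pos (-l)).le (by simp [hl.le]) P
  have : ∫ ω, (Real.exp (-(l * ν ω)) - 1 + l * ν ω) ∂P
      = (∫ ω, Real.exp (-l) ^ ν ω ∂P) - 1 + l := by
    simp only [← exp_neg_pow]
    rw [integral_add (f := fun ω => Real.exp (-l) ^ ν ω - 1) (hip.sub (integrable_const _))
      ((integrable_of_mean_eq_one h.mean_eq_one).const_mul l),
      integral_sub hip (integrable_const _), integral_const_mul, h.mean_eq_one]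
    simp
  rw [integral_div, this, ← sub_div]
  congr 1
  ring

/-- The logarithm comes from `∫ dt / t` over `l < t < 1`. With `L = -log l` and `t = exp (-(L * u))`
this range becomes `0 < u < 1`, and division by `l² L` leaves an integrand tending to `c` there and
to `0` outside. -/
theorem tendsto_generating_of_eq_two (h : HasJointTail P νt ν 2 c γ) :
    Tendsto (fun l : ℝ => ((∫ ω, Real.exp (-l) ^ ν ω ∂P) - Real.exp (-l))
      / (l ^ 2 * -Real.log l)) (𝓝[>] 0) (𝓝 c) := by
  obtain ⟨D, hD, hbound⟩ := h.exists_tail_bound (by norm_num)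
  have hlim : Tendsto (fun v : ℝ => v ^ 2 * P.real {ω | v < (ν ω : ℝ)}) atTop (𝓝 c) := by
    simpa using h.tendsto_tail
  have hbd : ∀ v : ℝ, 0 < v → v ^ 2 * P.real {ω | v < (ν ω : ℝ)} ≤ D := by
    intro v hv
    have := hbound v hv
    rw [Real.rpow_neg hv.le, Real.rpow_two, ← div_eq_mul_inv, le_div_iff₀ (by positivity)] at this
    linarith
  have hpos : ∀ᶠ l : ℝ in 𝓝[>] 0, l ∈ Ioo (0:ℝ) 1 := Ioo_mem_nhdsGT (zero_lt_one' ℝ)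
  have hlog : Tendsto (fun l : ℝ => -Real.log l) (𝓝[>] 0) atTop :=
    tendsto_neg_atBot_atTop.comp Real.tendsto_log_nhdsGT_zero
  have hmain : Tendsto (fun L : ℝ => ∫ u : ℝ,
      ((1 - Real.exp (-Real.exp (-(L * u)))) / Real.exp (-(L * u))) *
      (Real.exp (L * (1 - u)) ^ 2 * P.real {ω | Real.exp (L * (1 - u)) < ν ω})) atTop
      (𝓝 (∫ u : ℝ, (Ioo (0:ℝ) 1).indicator (fun _ => c) u)) := by
    have hfac : ∀ x : ℝ, 0 < x → 0 ≤ (1 - Real.exp (-x)) / x := fun x hx =>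
      div_nonneg (by simp [hx.le]) hx.le
    have hfac1 : ∀ x : ℝ, 0 < x → (1 - Real.exp (-x)) / x ≤ 1 := fun x hx => by
      rw [div_le_one hx]; exact one_sub_exp_neg_le x
    have hfac2 : ∀ x : ℝ, 0 < x → (1 - Real.exp (-x)) / x ≤ 1 / x := fun x hx => by
      gcongr; linarith [Real.exp_pos (-x)]
    -- For `L ≥ 1`, the first factor is at most `exp u` for `u ≤ 0`, and at most `1` on `[0, 1]`,
    -- while the second is at most `D`. For `u ≥ 1`, bounding the probability by `1` leaves `exp (2
    -- L (1 - u)) ≤ exp (1 - u)`.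
    refine tendsto_integral_filter_of_dominated_convergence
      (fun u => (D + 1) * Real.exp 1 * Real.exp (-|u|)) ?_ ?_ ?_ ?_
    · refine Eventually.of_forall fun L => Measurable.aestronglyMeasurable ?_
      have := (antitone_tail (P := P) ν).measurable.comp
        (by fun_prop : Measurable fun u : ℝ => Real.exp (L * (1 - u)))
      exact Measurable.mul (by fun_prop) (Measurable.mul (by fun_prop) this)
    · filter_upwards [eventually_ge_atTop 1] with L hL
      refine ae_of_all _ fun u => ?_
      have hx := Real.exp_pos (-(L * u))
      have hv := Real.exp_pos (L * (1 - u))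
      have hP1 : P.real {ω | Real.exp (L * (1 - u)) < ν ω} ≤ 1 := measureReal_le_one
      have hP0 : 0 ≤ P.real {ω | Real.exp (L * (1 - u)) < ν ω} := measureReal_nonneg
      have hk0 := mul_nonneg (sq_nonneg (Real.exp (L * (1 - u)))) hP0
      rw [Real.norm_of_nonneg (mul_nonneg (hfac _ hx) hk0), mul_assoc, ← Real.exp_add]
      rcases le_total u 1 with hu1 | hu1
      · rw [mul_comm]
        refine mul_le_mul ((hbd _ hv).trans (by linarith)) ?_ (hfac _ hx) (by linarith)
        rcases le_total u 0 with hu0 | hu0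
        · refine (hfac2 _ hx).trans ?_
          rw [one_div, ← Real.exp_neg, Real.exp_le_exp, abs_of_nonpos hu0]
          nlinarith
        · refine (hfac1 _ hx).trans ?_
          rw [abs_of_nonneg hu0, Real.one_le_exp_iff]
          linarith
      · calc _ ≤ 1 * (Real.exp (L * (1 - u)) ^ 2 * 1) := by
              refine mul_le_mul (hfac1 _ hx) (by gcongr) hk0 zero_le_one
          _ = Real.exp (2 * (L * (1 - u))) := by
              rw [← Real.exp_nat_mul]; simp
          _ ≤ Real.exp (1 + -|u|) := by
              rw [Real.exp_le_exp, abs_of_nonneg (by linarith)]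
              nlinarith
          _ ≤ _ := le_mul_of_one_le_left (Real.exp_pos _).le (by linarith)
    · exact integrable_exp_neg_abs_real.const_mul _
    · filter_upwards [Measure.ae_ne volume (0:ℝ), Measure.ae_ne volume (1:ℝ)] with u hu0 hu1
      rcases lt_or_gt_of_ne hu0 with hn | hp
      · rw [indicator_of_notMem (fun hm => absurd hm.1 (not_lt.2 hn.le))]
        have hx : Tendsto (fun L : ℝ => D * Real.exp (L * u)) atTop (𝓝 0) := by
          have := (Real.tendsto_exp_atBot.comp
            (tendsto_id.atTop_mul_const_of_neg hn)).const_mul D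
          simpa using this
        refine squeeze_zero (fun L => mul_nonneg (hfac _ (Real.exp_pos _)) (by positivity))
          (fun L => ?_) hx
        rw [mul_comm]
        refine mul_le_mul (hbd _ (Real.exp_pos _)) ((hfac2 _ (Real.exp_pos _)).trans ?_)
          (hfac _ (Real.exp_pos _)) hD.le
        rw [one_div, ← Real.exp_neg, neg_neg]
      · rcases lt_or_gt_of_ne hu1 with hl | hg
        · rw [indicator_of_mem (show u ∈ Ioo (0:ℝ) 1 from ⟨hp, hl⟩)]
          have h1 : Tendsto (fun L : ℝ => Real.exp (-(L * u))) atTop (𝓝[>] 0) :=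
            tendsto_nhdsWithin_iff.2 ⟨Real.tendsto_exp_neg_atTop_nhds_zero.comp
              (tendsto_id.atTop_mul_const hp), Eventually.of_forall fun L => Real.exp_pos _⟩
          have h2 : Tendsto (fun L : ℝ => Real.exp (L * (1 - u))) atTop atTop :=
            Real.tendsto_exp_atTop.comp (tendsto_id.atTop_mul_const (by linarith))
          have := (tendsto_one_sub_exp_neg_div.comp h1).mul (hlim.comp h2)
          simpa using this
        · rw [indicator_of_notMem (fun hm => absurd hm.2 (not_lt.2 hg.le))]
          have h2 : Tendsto (fun L : ℝ => Real.exp (L * (1 - u)) ^ 2) atTop (𝓝 0) := by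
            have := (Real.tendsto_exp_atBot.comp
              (tendsto_id.atTop_mul_const_of_neg (by linarith : 1 - u < 0))).pow 2
            simpa using this
          refine squeeze_zero (fun L => mul_nonneg (hfac _ (Real.exp_pos _)) (by positivity))
            (fun L => ?_) h2
          refine (mul_le_of_le_one_left (by positivity) (hfac1 _ (Real.exp_pos _))).trans ?_
          exact mul_le_of_le_one_right (by positivity) measureReal_le_one
  have hc : ∫ u : ℝ, (Ioo (0:ℝ) 1).indicator (fun _ => c) u = c := by
    rw [integral_indicator measurableSet_Ioo]; simp
  rw [hc] at hmain
  have hrem : Tendsto (fun l : ℝ => (Real.exp (-l) - 1 + l) / l ^ 2 * (-Real.log l)⁻¹)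
      (𝓝[>] 0) (𝓝 0) := by
    simpa using tendsto_exp_neg_sub_one_add_div_sq.mul (tendsto_inv_atTop_zero.comp hlog)
  have := (hmain.comp hlog).sub hrem
  rw [sub_zero] at this
  refine this.congr' ?_
  filter_upwards [hpos] with l hl
  have hl0 : 0 < l := hl.1
  have hL : 0 < -Real.log l := by linarith [Real.log_neg hl.1 hl.2]
  have e := integral_exp_neg_pow_sub h.measurable_ν h.mean_eq_one hl0
  simp only [Function.comp]
  set L := -Real.log l with hLd
  have hlL : l = Real.exp (-L) := by rw [hLd, neg_neg, Real.exp_log hl0]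
  have himage : (fun u : ℝ => Real.exp (-(L * u))) '' univ = Ioi 0 := by
    ext t
    constructor
    · rintro ⟨u, -, rfl⟩
      exact Real.exp_pos _
    · intro ht
      refine ⟨-(Real.log t / L), mem_univ _, ?_⟩
      have : -(L * -(Real.log t / L)) = Real.log t := by field_simp
      simp only [this]
      exact Real.exp_log ht
  -- Change of variables `t = exp (-(L * u))` from the real line onto the positive half-line.
  have hsub := integral_image_eq_integral_abs_deriv_smul (s := univ)
    (f := fun u : ℝ => Real.exp (-(L * u))) (f' := fun u => -(L * Real.exp (-(L * u))))
    MeasurableSet.univ (fun u _ => by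
      have := ((((hasDerivAt_id u).const_mul L).fun_neg).exp).hasDerivWithinAt (s := univ)
      simpa [mul_comm] using this)
    (fun u _ w _ huw => by
      have := Real.exp_injective huw
      have : L * u = L * w := by linarith
      exact mul_left_cancel₀ hL.ne' this)
    (fun t => P.real {ω | t / l < ν ω} * (1 - Real.exp (-t)))
  rw [himage, Measure.restrict_univ] at hsub
  have hint : (∫ ω, Real.exp (-l) ^ ν ω ∂P) - 1 + l = l ^ 2 * L * ∫ u : ℝ,
      ((1 - Real.exp (-Real.exp (-(L * u)))) / Real.exp (-(L * u))) *
      (Real.exp (L * (1 - u)) ^ 2 * P.real {ω | Real.exp (L * (1 - u)) < ν ω}) := by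
    rw [e, hsub, ← integral_const_mul]
    congr 1
    ext u
    have hdiv : Real.exp (L * (1 - u)) = Real.exp (-(L * u)) / l := by
      rw [hlL, ← Real.exp_sub]; ring_nf
    rw [hdiv, abs_neg, abs_of_pos (by positivity), smul_eq_mul]
    have := (Real.exp_pos (-(L * u))).ne'
    field_simp
  have hsplit : (∫ ω, Real.exp (-l) ^ ν ω ∂P) - Real.exp (-l)
      = ((∫ ω, Real.exp (-l) ^ ν ω ∂P) - 1 + l) - (Real.exp (-l) - 1 + l) := by ring
  rw [hsplit, hint]
  field_simp

end HasJointTail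

end Model

/-! ### The constant as a crossing point -/

theorem isEquivalent_of_tendsto_div {x s : ℝ → ℝ} {C : ℝ} (hC : C ≠ 0)
    (hs : ∀ᶠ r in atTop, 0 < s r) (h : Tendsto (fun r => x r / s r) atTop (𝓝 C)) :
    x ~[atTop] fun r => C * s r := by
  refine isEquivalent_of_tendsto_one ?_
  have := h.div_const C
  rw [div_self hC] at this
  refine this.congr' ?_
  filter_upwards [hs] with r hr
  simp only [Pi.div_apply]
  field_simp

/-- A strictly increasing and a non-increasing function cross exactly once. -/
theorem exists_crossing {K G : ℝ → ℝ} {B : ℝ} (hK : StrictMonoOn K (Ioi 0))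
    (hK0 : Tendsto K (𝓝[>] 0) (𝓝 0)) (hKtop : Tendsto K atTop atTop) (hG : AntitoneOn G (Ioi 0))
    (hG1 : 0 < G 1) (hGB : ∀ y, 0 < y → G y ≤ B) :
    ∃ C : ℝ, 0 < C ∧ (∀ y, 0 < y → y < C → K y < G y) ∧ ∀ y, C < y → G y < K y := by
  -- The crossing point is the supremum of `{y > 0 | K y ≤ G y}`: non-empty since `K` is small near
  -- `0` while `G ≥ G 1 > 0` there, and bounded since `K` eventually exceeds `B`. Strict
  -- monotonicity of `K` makes the inequality strict below it.
  obtain ⟨z, hz, hz1⟩ := ((hK0.eventually_lt_const hG1).and (Ioo_mem_nhdsGT (zero_lt_one' ℝ))).exists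
  have hzS : z ∈ {y | 0 < y ∧ K y ≤ G y} :=
    ⟨hz1.1, hz.le.trans (hG hz1.1 (zero_lt_one' ℝ) hz1.2.le)⟩
  obtain ⟨Y, hY⟩ := eventually_atTop.1 (hKtop.eventually_gt_atTop B)
  have hbdd : BddAbove {y | 0 < y ∧ K y ≤ G y} := by
    refine ⟨Y, fun y hy => ?_⟩
    by_contra! hlt
    linarith [hY y hlt.le, hGB y hy.1, hy.2]
  have hC : 0 < sSup {y | 0 < y ∧ K y ≤ G y} := hz1.1.trans_le (le_csSup hbdd hzS)
  refine ⟨_, hC, fun y hy0 hyC => ?_, fun y hyC => ?_⟩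
  · obtain ⟨w, hw, hyw⟩ := exists_lt_of_lt_csSup ⟨z, hzS⟩ hyC
    exact (hK hy0 hw.1 hyw).trans_le (hw.2.trans (hG hy0 hw.1 hyw.le))
  · by_contra! hle
    exact absurd (le_csSup hbdd ⟨hC.trans hyC, hle⟩) (not_le.2 hyC)

/-- The limit of the rescaled right-hand side of the functional equation at the point `y / r`. -/
noncomputable def limitRHS (γ : ℝ≥0 → ℝ) (y : ℝ) : ℝ :=
  γ 0 - ∫ t in Ioi (0:ℝ), γ (t / y).toNNReal * Real.exp (-t)

section LimitRHS

variable {γ : ℝ≥0 → ℝ}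

theorem integrableOn_limitRHS (hγ_pos : ∀ b, 0 < γ b) (hγ : Antitone γ) (y : ℝ) :
    IntegrableOn (fun t : ℝ => γ (t / y).toNNReal * Real.exp (-t)) (Ioi 0) := by
  refine ((integrableOn_exp_neg_Ioi 0).const_mul (γ 0)).mono' ?_ (ae_of_all _ fun t => ?_)
  · have h1 : Measurable fun t : ℝ => (t / y).toNNReal := by fun_prop
    exact ((hγ.measurable.comp h1).mul (by fun_prop)).aestronglyMeasurable
  · rw [Real.norm_of_nonneg (mul_nonneg (hγ_pos _).le (Real.exp_pos _).le)]
    exact mul_le_mul_of_nonneg_right (hγ zero_le) (Real.exp_pos _).le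

theorem limitRHS_antitoneOn (hγ_pos : ∀ b, 0 < γ b) (hγ : Antitone γ) :
    AntitoneOn (limitRHS γ) (Ioi 0) := by
  intro y hy z _ hyz
  refine sub_le_sub_left (setIntegral_mono_on (integrableOn_limitRHS hγ_pos hγ y)
    (integrableOn_limitRHS hγ_pos hγ z) measurableSet_Ioi fun t ht => ?_) _
  refine mul_le_mul_of_nonneg_right (hγ (Real.toNNReal_le_toNNReal ?_)) (Real.exp_pos _).le
  exact div_le_div_of_nonneg_left (le_of_lt ht) hy hyz

theorem limitRHS_le (hγ_pos : ∀ b, 0 < γ b) (y : ℝ) : limitRHS γ y ≤ γ 0 :=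
  sub_le_self _ (integral_nonneg fun _ => mul_nonneg (hγ_pos _).le (Real.exp_pos _).le)

/-- As `∫ exp (-t) = 1`, the value is the integral of `(γ 0 - γ t) exp (-t)`, which is nonnegative
and strictly positive for `t > B`. -/
theorem limitRHS_one_pos (hγ_pos : ∀ b, 0 < γ b) (hγ : Antitone γ) {B : ℝ≥0} (hB : γ B < γ 0) :
    0 < limitRHS γ 1 := by
  have hi := (integrableOn_exp_neg_Ioi 0).const_mul (γ 0)
  have hi' := integrableOn_limitRHS hγ_pos hγ 1
  have e : limitRHS γ 1 =
      ∫ t in Ioi (0:ℝ), (γ 0 * Real.exp (-t) - γ (t / 1).toNNReal * Real.exp (-t)) := by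
    rw [integral_sub hi hi', integral_const_mul, integral_exp_neg_Ioi_zero, mul_one, limitRHS]
  rw [e, setIntegral_pos_iff_support_of_nonneg_ae
    (f := fun t : ℝ => γ 0 * Real.exp (-t) - γ (t / 1).toNNReal * Real.exp (-t)) (ae_of_all _ fun t => ?_) (hi.sub hi')]
  · refine lt_of_lt_of_le ?_ (measure_mono (s := Ioi (B : ℝ)) fun t ht => ⟨?_, ?_⟩)
    · simp
    · have h1 : γ (t / 1).toNNReal ≤ γ B := hγ (by
        rw [div_one]; exact NNReal.le_toNNReal_of_coe_le (le_of_lt ht))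
      have : 0 < (γ 0 - γ (t / 1).toNNReal) * Real.exp (-t) :=
        mul_pos (by linarith) (Real.exp_pos _)
      rw [sub_mul] at this
      exact this.ne'
    · exact B.coe_nonneg.trans_lt ht
  · show 0 ≤ γ 0 * Real.exp (-t) - γ (t / 1).toNNReal * Real.exp (-t)
    rw [← sub_mul]
    exact mul_nonneg (sub_nonneg.2 (hγ zero_le)) (Real.exp_pos _).le

end LimitRHS

/-! ### The right-hand side at the test points, and second moments -/

section Model

variable {Ω : Type u} [MeasurableSpace Ω] {P : Measure Ω} [IsProbabilityMeasure P]

namespace HasJointTail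

variable {νt : Ω → ℝ≥0} {ν : Ω → ℕ} {α c : ℝ} {γ : ℝ≥0 → ℝ}

/-- For `l = y / r` the level `t / l` equals `(t / y) r`, so the joint tail applies with `b = t /
y`. -/
theorem tendsto_setIntegral_exp_div (h : HasJointTail P νt ν α c γ) {y : ℝ} (hy : 0 < y) :
    Tendsto (fun r : ℝ => r ^ α *
      ∫ ω in {ω | r < (νt ω : ℝ)}, Real.exp (-(y * r⁻¹)) ^ ν ω ∂P) atTop (𝓝 (limitRHS γ y)) := by
  refine h.tendsto_setIntegral_exp (l := fun r => y * r⁻¹) ?_ fun t ht => ?_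
  · filter_upwards [eventually_gt_atTop 0] with r hr
    positivity
  · refine (h.tendsto_joint_tail (Real.toNNReal_pos.2 (div_pos ht hy))).congr fun r => ?_
    rw [Real.coe_toNNReal _ (div_pos ht hy).le]
    simp only [div_mul_eq_mul_div, div_mul_eq_div_div, div_inv_eq_mul]

/-- When `r l → 0`, the level `t / l` is far above `r`: the tail bound for `ν` alone gives `r^α P(ν
> t/l) ≤ D t^(-α) (r l)^α → 0`. -/
theorem tendsto_setIntegral_exp_of_small (h : HasJointTail P νt ν α c γ) (hα : 0 < α)
    {l : ℝ → ℝ} (hl : ∀ᶠ r in atTop, 0 < l r) (hl0 : Tendsto (fun r => r * l r) atTop (𝓝 0)) :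
    Tendsto (fun r : ℝ => r ^ α * ∫ ω in {ω | r < (νt ω : ℝ)}, Real.exp (-l r) ^ ν ω ∂P) atTop
      (𝓝 (γ 0)) := by
  obtain ⟨D, hD, hbound⟩ := h.exists_tail_bound hα
  have := h.tendsto_setIntegral_exp (g := fun _ => 0) hl fun t ht => ?_
  · simpa using this
  have hz : Tendsto (fun r => D * t ^ (-α) * (r * l r) ^ α) atTop (𝓝 0) := by
    have h1 := (Real.continuousAt_rpow_const (0:ℝ) α (Or.inr hα.le)).tendsto.comp hl0
    rw [Real.zero_rpow hα.ne'] at h1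
    simpa using h1.const_mul (D * t ^ (-α))
  refine squeeze_zero' ?_ ?_ hz
  · filter_upwards [eventually_ge_atTop 0] with r hr
    positivity
  · filter_upwards [eventually_gt_atTop 0, hl] with r hr hlr
    have h1 : P.real ({ω | r < (νt ω : ℝ)} ∩ {ω | t / l r < ν ω}) ≤ D * (t / l r) ^ (-α) :=
      (measureReal_mono inter_subset_right).trans (hbound _ (by positivity))
    refine (mul_le_mul_of_nonneg_left h1 (by positivity)).trans_eq ?_
    rw [Real.div_rpow ht.le hlr.le, Real.rpow_neg hlr.le, div_inv_eq_mul,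
      Real.mul_rpow hr.le hlr.le]
    ring

/-- Layer-cake formula for `x²`: the integrand `2 t P(ν > t)` is at most `2 D t^(1-α)`, integrable
at infinity exactly because `α > 2`. -/
theorem integrable_sq (h : HasJointTail P νt ν α c γ) (hα : 2 < α) :
    Integrable (fun ω => (ν ω : ℝ) ^ 2) P := by
  obtain ⟨D, hD, hbound⟩ := h.exists_tail_bound (by linarith)
  have hνm : Measurable fun ω => (ν ω : ℝ) := measurable_from_nat.comp h.measurable_ν
  have hprim : ∀ x : ℝ, ∫ t in (0:ℝ)..x, 2 * t = x ^ 2 := fun x => by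
    rw [intervalIntegral.integral_const_mul, integral_id]; ring
  have hcake := lintegral_comp_eq_lintegral_meas_lt_mul P (f := fun ω => (ν ω : ℝ))
    (g := fun t => 2 * t) (ae_of_all _ fun ω => by positivity) hνm.aemeasurable
    (fun t _ => (by fun_prop : Continuous fun t : ℝ => 2 * t).intervalIntegrable _ _)
    ((ae_restrict_iff' measurableSet_Ioi).2 (ae_of_all _ fun t ht => by
      have : (0:ℝ) < t := ht
      positivity))
  simp only [hprim] at hcake
  have hmeas : AEStronglyMeasurable (fun t : ℝ => P.real {ω | t < (ν ω : ℝ)} * (2 * t)) :=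
    ((antitone_tail (P := P) ν).measurable.mul (by fun_prop)).aestronglyMeasurable
  have hint : IntegrableOn (fun t : ℝ => P.real {ω | t < (ν ω : ℝ)} * (2 * t)) (Ioi 0) := by
    rw [← Ioc_union_Ioi_eq_Ioi (zero_le_one' ℝ)]
    refine IntegrableOn.union ?_ ?_
    · refine (integrableOn_const (C := (2:ℝ)) (by simp)).mono' hmeas.restrict
        ((ae_restrict_iff' measurableSet_Ioc).2 (ae_of_all _ fun t ht => ?_))
      have ht0 : (0:ℝ) < t := ht.1
      have h1 : P.real {ω | t < (ν ω : ℝ)} ≤ 1 := measureReal_le_one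
      rw [Real.norm_of_nonneg (by positivity)]
      exact (mul_le_of_le_one_left (by positivity) h1).trans (by linarith [ht.2])
    · refine ((integrableOn_Ioi_rpow_of_lt (a := 1 - α) (by linarith) zero_lt_one).const_mul
        (2 * D)).mono' hmeas.restrict ((ae_restrict_iff' measurableSet_Ioi).2
        (ae_of_all _ fun t ht => ?_))
      have ht0 : (0:ℝ) < t := zero_lt_one.trans ht
      rw [Real.norm_of_nonneg (by positivity)]
      calc _ ≤ D * t ^ (-α) * (2 * t) := by gcongr; exact hbound t ht0
        _ = 2 * D * (t ^ (-α) * t) := by ring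
        _ = _ := by rw [← Real.rpow_add_one ht0.ne']; ring_nf
  refine ⟨(hνm.pow_const 2).aestronglyMeasurable, ?_⟩
  rw [hasFiniteIntegral_iff_ofReal (ae_of_all _ fun ω => by positivity), hcake]
  refine lt_of_eq_of_lt ?_ hint.lintegral_lt_top
  refine lintegral_congr fun t => ?_
  rw [ENNReal.ofReal_mul measureReal_nonneg, measureReal_def,
    ENNReal.ofReal_toReal (measure_ne_top _ _)]

/-- `E[ν²] - 1` is the variance of `ν`. If it vanished, `ν = 1` almost surely and the tail would be
eventually zero, against `c > 0`. -/
theorem one_lt_integral_sq (h : HasJointTail P νt ν α c γ) (hc : 0 < c)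
    (hi : Integrable (fun ω => (ν ω : ℝ) ^ 2) P) : 1 < ∫ ω, (ν ω : ℝ) ^ 2 ∂P := by
  have hi1 := integrable_of_mean_eq_one h.mean_eq_one
  have hexp : ∀ ω, ((ν ω : ℝ) - 1) ^ 2 = (ν ω : ℝ) ^ 2 - 2 * ν ω + 1 := fun ω => by ring
  have hisq : Integrable (fun ω => ((ν ω : ℝ) - 1) ^ 2) P := by
    simp only [hexp]
    exact (hi.sub (hi1.const_mul 2)).add (integrable_const 1)
  have e : ∫ ω, ((ν ω : ℝ) - 1) ^ 2 ∂P = (∫ ω, (ν ω : ℝ) ^ 2 ∂P) - 1 := by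
    simp only [hexp]
    rw [integral_add (f := fun ω => (ν ω : ℝ) ^ 2 - 2 * ν ω) (hi.sub (hi1.const_mul 2))
      (integrable_const 1), integral_sub hi (hi1.const_mul 2), integral_const_mul, h.mean_eq_one]
    simp; ring
  have hnn : 0 ≤ ∫ ω, ((ν ω : ℝ) - 1) ^ 2 ∂P := integral_nonneg fun ω => sq_nonneg _
  refine lt_of_le_of_ne (by linarith) fun heq => ?_
  have hz : ∫ ω, ((ν ω : ℝ) - 1) ^ 2 ∂P = 0 := by linarith
  rw [integral_eq_zero_iff_of_nonneg (fun ω => sq_nonneg _) hisq] at hz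
  have htail : Tendsto (fun r : ℝ => r ^ α * P.real {ω | r < (ν ω : ℝ)}) atTop (𝓝 0) := by
    refine tendsto_const_nhds.congr' ?_
    filter_upwards [eventually_ge_atTop 1] with r hr
    have : P {ω | r < (ν ω : ℝ)} = 0 := by
      refine measure_mono_null (fun ω hω => ?_) (ae_iff.1 hz)
      have hω' : r < ν ω := hω
      show ¬ (((ν ω : ℝ) - 1) ^ 2 = 0)
      have : 0 < (ν ω : ℝ) - 1 := by linarith
      positivity
    simp [measureReal_def, this]
  exact hc.ne' (tendsto_nhds_unique h.tendsto_tail htail)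

end HasJointTail

/-! ### The three regimes -/

namespace IsTailModel

variable {Ω' : Type v} [MeasurableSpace Ω'] {P' : Measure Ω'} [IsProbabilityMeasure P']
  {νt : Ω → ℝ≥0} {ν : Ω → ℕ} {M : Ω' → ℝ≥0} {α c : ℝ} {γ : ℝ≥0 → ℝ}

theorem tendsto_mul_tail_of_lt_two (h : IsTailModel P P' νt ν M α c γ) (h1 : 1 < α) (h2 : α < 2)
    {C : ℝ} (hC : 0 < C)
    (hlt : ∀ y, 0 < y → y < C →
      y ^ α * (c * ∫ t in Ioi (0:ℝ), t ^ (-α) * (1 - Real.exp (-t))) < limitRHS γ y)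
    (hgt : ∀ y, C < y →
      limitRHS γ y < y ^ α * (c * ∫ t in Ioi (0:ℝ), t ^ (-α) * (1 - Real.exp (-t)))) :
    Tendsto (fun r => P'.real {ω | r < (M ω : ℝ)} / r⁻¹) atTop (𝓝 C) := by
  have hpos := eventually_gt_atTop (0:ℝ)
  refine h.tendsto_div (a := fun r => r ^ (-α)) hC (hpos.mono fun r hr => inv_pos.2 hr)
    tendsto_inv_atTop_zero (hpos.mono fun r hr => Real.rpow_pos_of_pos hr _) (fun y hy => ?_)
    (fun y hy => ?_) hlt hgt
  · have hl : Tendsto (fun r : ℝ => y * r⁻¹) atTop (𝓝[>] 0) := by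
      refine tendsto_nhdsWithin_iff.2 ⟨by simpa using tendsto_inv_atTop_zero.const_mul y, ?_⟩
      filter_upwards [hpos] with r hr
      exact mul_pos hy (inv_pos.2 hr)
    refine (((h.hasJointTail.tendsto_generating_of_lt_two h1 h2).comp hl).const_mul
      (y ^ α)).congr' ?_
    filter_upwards [hpos] with r hr
    simp only [Function.comp]
    rw [Real.mul_rpow hy.le (inv_nonneg.2 hr.le), Real.inv_rpow hr.le, Real.rpow_neg hr.le]
    have := (Real.rpow_pos_of_pos hy α).ne'
    field_simp
  · refine (h.hasJointTail.tendsto_setIntegral_exp_div hy).congr' ?_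
    filter_upwards [hpos] with r hr
    rw [Real.rpow_neg hr.le, div_inv_eq_mul, mul_comm]

/-- For `l = y / (r √(log r))` one has `log (1/l) ∼ log r`, so the left side is asymptotic to `c y²
/ r²`, to be balanced with `γ 0 / r²`. -/
theorem tendsto_tail_div_of_eq_two (h : IsTailModel P P' νt ν M 2 c γ) (hc : 0 < c)
    (hγ : 0 < γ 0) :
    Tendsto (fun r => P'.real {ω | r < (M ω : ℝ)} / (r * Real.sqrt (Real.log r))⁻¹) atTop
      (𝓝 (Real.sqrt (γ 0 / c))) := by
  have hpos := eventually_gt_atTop (1:ℝ)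
  have hsqrt : Tendsto (fun r => Real.sqrt (Real.log r)) atTop atTop :=
    Real.tendsto_sqrt_atTop.comp Real.tendsto_log_atTop
  have hs : ∀ᶠ r : ℝ in atTop, 0 < (r * Real.sqrt (Real.log r))⁻¹ := by
    filter_upwards [hpos] with r hr
    have := Real.log_pos hr
    positivity
  have hs0 : Tendsto (fun r => (r * Real.sqrt (Real.log r))⁻¹) atTop (𝓝 0) :=
    tendsto_inv_atTop_zero.comp (tendsto_id.atTop_mul_atTop₀ hsqrt)
  refine h.tendsto_div (a := fun r => (r ^ 2)⁻¹) (K := fun y => c * y ^ 2) (G := fun _ => γ 0)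
    (by positivity) hs hs0 (hpos.mono fun r hr => by positivity) (fun y hy => ?_)
    (fun y hy => ?_) (fun y hy hyC => ?_) (fun y hyC => ?_)
  · have hl : Tendsto (fun r : ℝ => y * (r * Real.sqrt (Real.log r))⁻¹) atTop (𝓝[>] 0) := by
      refine tendsto_nhdsWithin_iff.2 ⟨by simpa using hs0.const_mul y, ?_⟩
      filter_upwards [hs] with r hr
      exact mul_pos hy hr
    have hll : Tendsto (fun r => Real.log (Real.log r) / Real.log r) atTop (𝓝 0) :=
      (Real.isLittleO_log_id_atTop.tendsto_div_nhds_zero).comp Real.tendsto_log_atTop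
    have hy' : Tendsto (fun r => Real.log y / Real.log r) atTop (𝓝 0) :=
      tendsto_const_nhds.div_atTop Real.tendsto_log_atTop
    -- For large `r` this expression is exactly `l² log (1/l) r²`, expanded through `log (1/l) = log
    -- r + (log log r) / 2 - log y`.
    have hw : Tendsto (fun r => y ^ 2 * (1 + 1 / 2 * (Real.log (Real.log r) / Real.log r)
        - Real.log y / Real.log r)) atTop (𝓝 (y ^ 2)) := by
      have := (((hll.const_mul (1 / 2)).const_add 1).sub hy').const_mul (y ^ 2)
      rwa [mul_zero, add_zero, sub_zero, mul_one] at this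
    refine (((h.hasJointTail.tendsto_generating_of_eq_two).comp hl).mul hw).congr' ?_
    have hlI : ∀ᶠ r : ℝ in atTop, y * (r * Real.sqrt (Real.log r))⁻¹ ∈ Ioo (0:ℝ) 1 :=
      hl (Ioo_mem_nhdsGT (zero_lt_one' ℝ))
    filter_upwards [hpos, hlI] with r hr hl1
    have hr0 : 0 < r := zero_lt_one.trans hr
    have hlr := Real.log_pos hr
    have hsq := Real.sqrt_pos.2 hlr
    have hneg := Real.log_neg hl1.1 hl1.2
    have hlogl : Real.log (y * (r * Real.sqrt (Real.log r))⁻¹)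
        = Real.log y - (Real.log r + 1 / 2 * Real.log (Real.log r)) := by
      rw [Real.log_mul hy.ne' (by positivity), Real.log_inv,
        Real.log_mul hr0.ne' hsq.ne', Real.log_sqrt hlr.le]
      ring
    have hl2 : (y * (r * Real.sqrt (Real.log r))⁻¹) ^ 2 = y ^ 2 / (r ^ 2 * Real.log r) := by
      rw [mul_pow, inv_pow, mul_pow, Real.sq_sqrt hlr.le, div_eq_mul_inv]
    simp only [Function.comp]
    have hwv : y ^ 2 * (1 + 1 / 2 * (Real.log (Real.log r) / Real.log r)
        - Real.log y / Real.log r) = (y * (r * Real.sqrt (Real.log r))⁻¹) ^ 2 *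
        -Real.log (y * (r * Real.sqrt (Real.log r))⁻¹) * r ^ 2 := by
      rw [hl2, hlogl]
      field_simp
      ring
    have hne : (y * (r * Real.sqrt (Real.log r))⁻¹) ^ 2 *
        -Real.log (y * (r * Real.sqrt (Real.log r))⁻¹) ≠ 0 := by
      have := pow_pos hl1.1 2
      exact (mul_pos this (by linarith)).ne'
    rw [hwv, ← mul_assoc, div_mul_cancel₀ _ hne, div_inv_eq_mul]
  · refine (h.hasJointTail.tendsto_setIntegral_exp_of_small two_pos
      (l := fun r => y * (r * Real.sqrt (Real.log r))⁻¹) (hs.mono fun r hr => mul_pos hy hr)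
      ?_).congr fun r => ?_
    · have := (tendsto_inv_atTop_zero.comp hsqrt).const_mul y
      rw [mul_zero] at this
      refine this.congr' ?_
      filter_upwards [hpos] with r hr
      have hr0 : 0 < r := zero_lt_one.trans hr
      simp only [Function.comp]
      field_simp
    · rw [Real.rpow_two, div_inv_eq_mul, mul_comm]
  · have : y ^ 2 < γ 0 / c := (Real.lt_sqrt hy.le).1 hyC
    rw [lt_div_iff₀ hc] at this
    linarith
  · have : γ 0 / c < y ^ 2 := (Real.sqrt_lt' ((Real.sqrt_nonneg _).trans_lt hyC)).1 hyC
    rw [div_lt_iff₀ hc] at this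
    linarith

/-- Both sides are normalised by `P(νt > r)` itself, so the balance is `(E[ν²] - 1) y² / 2 = 1`. The
scale `√P(νt > r)` is `o(1/r)` since `α > 2`. -/
theorem tendsto_tail_div_of_two_lt (h : IsTailModel P P' νt ν M α c γ) (hα : 2 < α) (hc : 0 < c)
    (hγ : 0 < γ 0) :
    (∀ᶠ r : ℝ in atTop, 0 < P.real {ω | r < (νt ω : ℝ)}) ∧
    Tendsto (fun r => P'.real {ω | r < (M ω : ℝ)} / Real.sqrt (P.real {ω | r < (νt ω : ℝ)})) atTop
      (𝓝 (Real.sqrt (2 / ((∫ ω, (ν ω : ℝ) ^ 2 ∂P) - 1)))) := by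
  have hi := h.hasJointTail.integrable_sq hα
  have hV := h.hasJointTail.one_lt_integral_sq hc hi
  have hV' : 0 < (∫ ω, (ν ω : ℝ) ^ 2 ∂P) - 1 := by linarith
  have hα0 : 0 < α := by linarith
  have htail := h.hasJointTail.tendsto_first_tail
  have hpos := eventually_gt_atTop (0:ℝ)
  have ha : ∀ᶠ r : ℝ in atTop, 0 < P.real {ω | r < (νt ω : ℝ)} := by
    filter_upwards [htail.eventually_const_lt hγ, hpos] with r hr hr0
    exact pos_of_mul_pos_right hr (Real.rpow_nonneg hr0.le _)
  refine ⟨ha, ?_⟩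
  have hs : ∀ᶠ r : ℝ in atTop, 0 < Real.sqrt (P.real {ω | r < (νt ω : ℝ)}) :=
    ha.mono fun r hr => Real.sqrt_pos.2 hr
  have hrs : Tendsto (fun r => r * Real.sqrt (P.real {ω | r < (νt ω : ℝ)})) atTop (𝓝 0) := by
    have hsq : Tendsto (fun r : ℝ => r ^ 2 * P.real {ω | r < (νt ω : ℝ)}) atTop (𝓝 0) := by
      have := (tendsto_rpow_neg_atTop (by linarith : 0 < α - 2)).mul htail
      rw [zero_mul] at this
      refine this.congr' ?_
      filter_upwards [hpos] with r hr
      rw [← mul_assoc, ← Real.rpow_add hr, ← Real.rpow_two]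
      ring_nf
    have := (Real.continuous_sqrt.tendsto 0).comp hsq
    rw [Real.sqrt_zero] at this
    refine this.congr' ?_
    filter_upwards [hpos] with r hr
    simp only [Function.comp]
    rw [Real.sqrt_mul (sq_nonneg r), Real.sqrt_sq hr.le]
  have hs0 : Tendsto (fun r => Real.sqrt (P.real {ω | r < (νt ω : ℝ)})) atTop (𝓝 0) := by
    have := hrs.mul tendsto_inv_atTop_zero
    rw [mul_zero] at this
    refine this.congr' ?_
    filter_upwards [hpos] with r hr
    field_simp
  refine h.tendsto_div (a := fun r => P.real {ω | r < (νt ω : ℝ)})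
    (K := fun y => ((∫ ω, (ν ω : ℝ) ^ 2 ∂P) - 1) / 2 * y ^ 2) (G := fun _ => 1)
    (by positivity) hs hs0 ha (fun y hy => ?_) (fun y hy => ?_) (fun y hy hyC => ?_)
    (fun y hyC => ?_)
  · have hl : Tendsto (fun r : ℝ => y * Real.sqrt (P.real {ω | r < (νt ω : ℝ)})) atTop
        (𝓝[>] 0) := by
      refine tendsto_nhdsWithin_iff.2 ⟨by simpa using hs0.const_mul y, ?_⟩
      filter_upwards [hs] with r hr
      exact mul_pos hy hr
    refine (((h.hasJointTail.tendsto_generating_of_integrable_sq hi).comp hl).mul_const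
      (y ^ 2)).congr' ?_
    filter_upwards [ha] with r hr
    simp only [Function.comp]
    rw [mul_pow, Real.sq_sqrt hr.le]
    field_simp
  · have h1 := h.hasJointTail.tendsto_setIntegral_exp_of_small hα0
      (l := fun r => y * Real.sqrt (P.real {ω | r < (νt ω : ℝ)}))
      (hs.mono fun r hr => mul_pos hy hr) (by simpa [mul_left_comm] using hrs.const_mul y)
    have h2 := h1.div htail hγ.ne'
    rw [div_self hγ.ne'] at h2
    refine h2.congr' ?_
    filter_upwards [hpos] with r hr
    simp only [Pi.div_apply]
    exact mul_div_mul_left _ _ (Real.rpow_pos_of_pos hr _).ne'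
  · have : y ^ 2 < 2 / ((∫ ω, (ν ω : ℝ) ^ 2 ∂P) - 1) := (Real.lt_sqrt hy.le).1 hyC
    rw [lt_div_iff₀ hV'] at this
    linarith
  · have : 2 / ((∫ ω, (ν ω : ℝ) ^ 2 ∂P) - 1) < y ^ 2 :=
      (Real.sqrt_lt' ((Real.sqrt_nonneg _).trans_lt hyC)).1 hyC
    rw [div_lt_iff₀ hV'] at this
    linarith

end IsTailModel

end Model

/-- Both curves are built from `α`, `γ` and `c` alone, hence so is their crossing point. The bound
on `γ` serves only to find `b` with `γ b < γ 0`: for constant `γ` the limiting right side would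
vanish and no positive crossing would exist. -/
theorem exists_constant_of_lt_two {α c : ℝ} {γ : ℝ≥0 → ℝ} (h1 : 1 < α) (h2 : α < 2) (hc : 0 < c)
    (hγ_pos : ∀ b : ℝ≥0, 0 < γ b) (hγ_anti : Antitone γ)
    (hγ_le : ∀ b : ℝ≥0, 0 < b → γ b ≤ c * (b : ℝ) ^ (-α)) :
    ∃ C : ℝ, 0 < C ∧
      (∀ y, 0 < y → y < C →
        y ^ α * (c * ∫ t in Ioi (0:ℝ), t ^ (-α) * (1 - Real.exp (-t))) < limitRHS γ y) ∧
      ∀ y, C < y →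
        limitRHS γ y < y ^ α * (c * ∫ t in Ioi (0:ℝ), t ^ (-α) * (1 - Real.exp (-t))) := by
  have hI := mul_pos hc (integral_rpow_neg_mul_one_sub_exp_pos h1 h2)
  have hα : 0 < α := by linarith
  refine exists_crossing (B := γ 0) (fun y hy z _ hyz => ?_) ?_ ?_
    (limitRHS_antitoneOn hγ_pos hγ_anti) ?_ (fun y _ => limitRHS_le hγ_pos y)
  · exact mul_lt_mul_of_pos_right (Real.rpow_lt_rpow (le_of_lt hy) hyz hα) hI
  · have := (Real.continuousAt_rpow_const (0:ℝ) α (Or.inr hα.le)).tendsto.mono_left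
      (nhdsWithin_le_nhds (s := Ioi 0))
    rw [Real.zero_rpow hα.ne'] at this
    simpa using this.mul_const (c * ∫ t in Ioi (0:ℝ), t ^ (-α) * (1 - Real.exp (-t)))
  · exact (tendsto_rpow_atTop hα).atTop_mul_const hI
  · have hz : Tendsto (fun b : ℝ => c * b ^ (-α)) atTop (𝓝 0) := by
      simpa using (tendsto_rpow_neg_atTop hα).const_mul c
    obtain ⟨b, hb, hb0⟩ := ((hz.eventually_lt_const (hγ_pos 0)).and
      (eventually_gt_atTop 0)).exists
    lift b to ℝ≥0 using hb0.le
    exact limitRHS_one_pos hγ_pos hγ_anti ((hγ_le b (by exact_mod_cast hb0)).trans_lt hb)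

theorem corollary1 (α c : ℝ) (γ : ℝ≥0 → ℝ) (hα : 0 < α) (hc : 0 < c)
    (hγ_pos : ∀ b : ℝ≥0, 0 < γ b) (hγ_anti : Antitone γ) :
    (1 < α → α < 2 → ∃ C : ℝ, 0 < C ∧
      ∀ (Ω : Type u) [MeasurableSpace Ω] (P : Measure Ω) [IsProbabilityMeasure P]
        (Ω' : Type v) [MeasurableSpace Ω'] (P' : Measure Ω') [IsProbabilityMeasure P']
        (νt : Ω → ℝ≥0) (ν : Ω → ℕ) (M : Ω' → ℝ≥0),
        IsTailModel P P' νt ν M α c γ →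
          (fun r : ℝ => P'.real {ω | r < (M ω : ℝ)}) ~[atTop] fun r : ℝ => C / r) ∧
    (α = 2 → ∃ C : ℝ, 0 < C ∧
      ∀ (Ω : Type u) [MeasurableSpace Ω] (P : Measure Ω) [IsProbabilityMeasure P]
        (Ω' : Type v) [MeasurableSpace Ω'] (P' : Measure Ω') [IsProbabilityMeasure P']
        (νt : Ω → ℝ≥0) (ν : Ω → ℕ) (M : Ω' → ℝ≥0),
        IsTailModel P P' νt ν M α c γ →
          (fun r : ℝ => P'.real {ω | r < (M ω : ℝ)})
            ~[atTop] fun r : ℝ => C / (r * Real.sqrt (Real.log r))) ∧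
    (2 < α →
      ∀ (Ω : Type u) [MeasurableSpace Ω] (P : Measure Ω) [IsProbabilityMeasure P]
        (Ω' : Type v) [MeasurableSpace Ω'] (P' : Measure Ω') [IsProbabilityMeasure P']
        (νt : Ω → ℝ≥0) (ν : Ω → ℕ) (M : Ω' → ℝ≥0),
        IsTailModel P P' νt ν M α c γ →
          Integrable (fun ω => (ν ω : ℝ) ^ 2) P ∧
          1 < ∫ ω, (ν ω : ℝ) ^ 2 ∂P ∧
          (fun r : ℝ => P'.real {ω | r < (M ω : ℝ)})
            ~[atTop] fun r : ℝ =>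
              Real.sqrt (2 / ((∫ ω, (ν ω : ℝ) ^ 2 ∂P) - 1) * P.real {ω | r < (νt ω : ℝ)})) := by
  refine ⟨fun h1 h2 => ?_, fun h2 => ?_, fun h2 => ?_⟩
  · by_cases hγ_le : ∀ b : ℝ≥0, 0 < b → γ b ≤ c * (b : ℝ) ^ (-α)
    · obtain ⟨C, hC, hlt, hgt⟩ := exists_constant_of_lt_two h1 h2 hc hγ_pos hγ_anti hγ_le
      refine ⟨C, hC, fun Ω _ P _ Ω' _ P' _ νt ν M h => ?_⟩
      simpa only [div_eq_mul_inv] using isEquivalent_of_tendsto_div hC.ne'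
        ((eventually_gt_atTop (0:ℝ)).mono fun r hr => inv_pos.2 hr)
        (h.tendsto_mul_tail_of_lt_two h1 h2 hC hlt hgt)
    · -- without the bound on `γ` there is no model
      exact ⟨1, one_pos, fun Ω _ P _ Ω' _ P' _ νt ν M h =>
        absurd (fun b hb => h.hasJointTail.gamma_le hb) hγ_le⟩
  · subst h2
    have hC : 0 < Real.sqrt (γ 0 / c) := Real.sqrt_pos.2 (div_pos (hγ_pos 0) hc)
    refine ⟨_, hC, fun Ω _ P _ Ω' _ P' _ νt ν M h => ?_⟩
    simpa only [div_eq_mul_inv] using isEquivalent_of_tendsto_div hC.ne'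
      ((eventually_gt_atTop (1:ℝ)).mono fun r hr => by
        have := Real.log_pos hr
        positivity) (h.tendsto_tail_div_of_eq_two hc (hγ_pos 0))
  · intro Ω _ P _ Ω' _ P' _ νt ν M h
    have hi := h.hasJointTail.integrable_sq h2
    have hV := h.hasJointTail.one_lt_integral_sq hc hi
    have hV' : 0 < 2 / ((∫ ω, (ν ω : ℝ) ^ 2 ∂P) - 1) := div_pos two_pos (by linarith)
    obtain ⟨ha, ht⟩ := h.tendsto_tail_div_of_two_lt h2 hc (hγ_pos 0)
    refine ⟨hi, hV, ?_⟩
    simp only [Real.sqrt_mul hV'.le]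
    exact isEquivalent_of_tendsto_div (Real.sqrt_pos.2 hV').ne'
      (ha.mono fun r hr => Real.sqrt_pos.2 hr) ht
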